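/- Let $m\ge 2$ and $p\ge 1$ be integers. Let $B_\ell$ be the set of cyclically reduced words of length at most $\ell$ in $x_1^{\pm1},\dots,x_m^{\pm1}$. Let $d\in\{-\infty\}\cup[0,1]$, and let $(G_\ell(m,d))$ be a sequence of random groups at density $d$, that is, $G_\ell(m,d)=\langle x_1,\dots,x_m\mid R_\ell\rangle$, where $R_\ell$ is a random subset of $B_\ell$ whose law is invariant under all permutations of the set $B_\ell$, and where the random variables $\log_{|B_\ell|}|R_\ell|$ (with $\log 0=-\infty$) converge in probability to $d$ as $\ell\to\infty$. A property holds a.a.s. if its probability tends to $1$ as $\ell\to\infty$. A piece with respect to $R_\ell$ is a common initial segment of two distinct elements of the symmetrized set of relators (all cyclic permutations of elements of $R_\ell$ and of their inverses). The presentation satisfies the Ollivier–Wise condition $B(2p)$ if half of a relator is never a product of at most $p$ pieces: every cyclic subword $s$ of a relator or inverse relator $r$ that is a product of at most $p$ pieces satisfies $|s|<\frac12|r|$. The condition with $|s|\le\frac12|r|$ in place of $|s|<\frac12|r|$ is called the non-strict form of $B(2p)$. Then, for both forms: (i) If $d<\frac1{2p+2}$, then a.a.s. $G_\ell(m,d)$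 satisfies $B(2p)$. (ii) If $d>\frac1{2p+2}$, then a.a.s. $G_\ell(m,d)$ does not satisfy $B(2p)$. -/

import Mathlib

open Filter Topology MeasureTheory

/-- Words in the letters `x₁^±, …, x_m^±`; the letter `(i, true)` is `x_i`, and `(i, false)` is its
inverse. -/
abbrev GWord (m : ℕ) : Type := List (Fin m × Bool)

/-- The set `B_ℓ` of cyclically reduced words of length at most `ℓ` in `m` generators. -/
def relatorBall (m ℓ : ℕ) : Set (GWord m) :=
  {w | FreeGroup.IsCyclicallyReduced w ∧ w.length ≤ ℓ}

instance relatorBall_finite (m ℓ : ℕ) : Finite (relatorBall m ℓ) :=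
  ((List.finite_length_le (Fin m × Bool) ℓ).subset fun _ h => h.2).to_subtype

/-- The density `log_{|E|} |A|` of a subset `A` of a finite set `E`, with `log 0 = -∞`. -/
noncomputable def subsetDensity {E : Type*} (A : Set E) : EReal :=
  open Classical in
  if A = ∅ then ⊥ else ((Real.logb (Nat.card E) A.ncard : ℝ) : EReal)

section RandomSubsets

universe u

variable {Ω : ℕ → Type u} [∀ ℓ, MeasurableSpace (Ω ℓ)]

/-- `R` is a random subset of the finite set `E`: the events `R = A` are measurable. -/
def IsRandomSubset {Ω' E : Type*} [MeasurableSpace Ω'] (R : Ω' → Set E) : Prop :=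
  ∀ A : Set E, MeasurableSet {ω | R ω = A}

/-- The law of the random subset `R` of `E` is invariant under all permutations of `E`. -/
def IsPermutationInvariant {Ω' E : Type*} [MeasurableSpace Ω'] (P : Measure Ω')
    (R : Ω' → Set E) : Prop :=
  ∀ (σ : Equiv.Perm E) (A : Set E), P {ω | R ω = σ '' A} = P {ω | R ω = A}

/-- The sequence of random subsets `R ℓ` of `E ℓ` is densable with density `d`, an element of
`{-∞} ∪ [0, 1]`: the densities of the `R ℓ` converge in probability to the constant `d`. -/
def IsDensable {E : ℕ → Type*} (P : ∀ ℓ, Measure (Ω ℓ)) (R : ∀ ℓ, Ω ℓ → Set (E ℓ))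
    (d : EReal) : Prop :=
  (d = ⊥ ∨ (0 ≤ d ∧ d ≤ 1)) ∧
    ∀ U ∈ 𝓝 d, Tendsto (fun ℓ => P ℓ {ω | subsetDensity (R ℓ ω) ∉ U}) atTop (𝓝 0)

/-- The event `Q ℓ` holds asymptotically almost surely. -/
def AAS (P : ∀ ℓ, Measure (Ω ℓ)) (Q : ∀ ℓ, Ω ℓ → Prop) : Prop :=
  Tendsto (fun ℓ => P ℓ {ω | Q ℓ ω}) atTop (𝓝 1)

/-- `R` is the sequence of random sets of relators of a sequence of random groups
`G_ℓ(m, d) = ⟨x₁, …, x_m | R_ℓ⟩` at density `d`: a densable sequence, with density `d`, of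
permutation invariant random subsets of the sets `B_ℓ`. -/
structure IsRandomGroupSequence (m : ℕ) (d : EReal) (P : ∀ ℓ, Measure (Ω ℓ))
    (R : ∀ ℓ, Ω ℓ → Set (relatorBall m ℓ)) : Prop where
  isRandomSubset : ∀ ℓ, IsRandomSubset (R ℓ)
  permutationInvariant : ∀ ℓ, IsPermutationInvariant (P ℓ) (R ℓ)
  densable : IsDensable P R d

end RandomSubsets

/-- The symmetrized set of relators: all cyclic permutations of the relators and of their
inverses. -/
def symmetrized {m : ℕ} (R : Set (GWord m)) : Set (GWord m) :=
  {w | ∃ r ∈ R, w.IsRotated r ∨ w.IsRotated (FreeGroup.invRev r)}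

/-- A piece: a common initial segment of two distinct elements of the symmetrized set of
relators. -/
def IsPiece {m : ℕ} (R : Set (GWord m)) (u : GWord m) : Prop :=
  ∃ w₁ ∈ symmetrized R, ∃ w₂ ∈ symmetrized R, w₁ ≠ w₂ ∧ u <+: w₁ ∧ u <+: w₂

/-- `s` is a product of at most `p` pieces. -/
def IsProductOfPieces {m : ℕ} (R : Set (GWord m)) (p : ℕ) (s : GWord m) : Prop :=
  ∃ L : List (GWord m), L.length ≤ p ∧ (∀ u ∈ L, IsPiece R u) ∧ L.flatten = s

/-- The condition `B(2p)` for the presentation `⟨x₁, …, x_m | R⟩`: a cyclic subword of a relator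
that is a product of at most `p` pieces is shorter than half of the relator. -/
def SatisfiesB {m : ℕ} (p : ℕ) (R : Set (GWord m)) : Prop :=
  ∀ r ∈ symmetrized R, ∀ s : GWord m, s <+: r → IsProductOfPieces R p s →
    2 * s.length < r.length

/-- The variant of `B(2p)` with a non-strict inequality: a cyclic subword of a relator that is a
product of at most `p` pieces is not longer than half of the relator. -/
def SatisfiesWeakB {m : ℕ} (p : ℕ) (R : Set (GWord m)) : Prop :=
  ∀ r ∈ symmetrized R, ∀ s : GWord m, s <+: r → IsProductOfPieces R p s →
    2 * s.length ≤ r.length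

/-! ### Permutation averaging for invariant random subsets. -/

section Averaging

open Finset

/-! Write `b = 2m - 1` and `θ = 1/(2p+2)`; then `|B_ℓ|` is `b ^ ℓ` up to constants. Invariance turns
probabilities into proportions of permutations `σ` with `σ '' A` having a given property, `A` being
a fixed set of the relevant size (`IsPermutationInvariant.measureReal_le`).

Below `θ`: a first moment bound. Let at most `p` pieces cover half of a relator `r`. If one of them
is longer than `θ|r|` and is a piece of `r` with itself, an overlap makes about `θ|r|` letters of
some cyclic conjugate of `r` or `r⁻¹` redundant. Otherwise every factor is either of length at most
`θ|r|` or shared with another relator. If `k` other relators, forming a set `T`, are used, the short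
factors cover at most `(p-k)θ|r|` of the required `(p+1)θ|r|`, so subwords of `T` cover at least
`(k+1)θ|r|`. In both cases (`k = 0` in the first) `T` leaves at most `b ^ (ℓ(1 - (k+1)θ))` choices
of `r`, up to a polynomial factor in `ℓ`. For a random set of `b ^ (cℓ)` relators the expected
number of pairs `(T, r)` is then about `b ^ ((k+1)(c-θ)ℓ)`, which tends to `0` for `c < θ`
(`exists_mem_badRelators_of_not_satisfiesB`, `card_badRelators_le`,
`measureReal_not_satisfiesB_le`).

Above `θ`: sampling in two stages. Relators of length `ℓ - 1` in a first sample of `b ^ (αℓ)`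
elements provide at least `b ^ (βℓ)` distinct initial segments of a length `L` just above `ℓ/(2p)`.
A second sample of the same size is likely to contain a relator of length `ℓ` that begins with `p`
of these segments: the expected number is about `b ^ ((α + pβ - 1/2)ℓ)`, and `α, β > θ` gives `α +
pβ > (p+1)θ = 1/2`. The segments are pieces because the lengths `ℓ - 1` and `ℓ` differ, and together
they exceed half of the relator (`measureReal_satisfiesWeakB_le`).

The strict form implies the non-strict one, so the strict form is proved in (i) and the non-strict
form refuted in (ii). -/

theorem measureReal_setOf_eq_sum {Ω' E : Type*} [MeasurableSpace Ω'] [Fintype (Set E)]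
    (P : Measure Ω') [IsProbabilityMeasure P] {R : Ω' → Set E} (hR : IsRandomSubset R)
    (Q : Set E → Prop) [DecidablePred Q] :
    P.real {ω | Q (R ω)} = ∑ A : Set E, if Q A then P.real {ω | R ω = A} else 0 := by
  rw [← Finset.sum_filter]
  have h : {ω | Q (R ω)} = ⋃ A ∈ (univ.filter Q : Finset (Set E)), {ω | R ω = A} := by
    ext ω; simp
  rw [h, measureReal_biUnion_finset]
  · intro A _ B _ hAB
    rw [Function.onFun, Set.disjoint_left]
    intro ω h1 h2
    exact hAB (h1.symm.trans h2)
  · intro A _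
    exact hR A

/-- Events for a permutation invariant random subset can be estimated by averaging over all
permutations of the ambient set. -/
theorem IsPermutationInvariant.measureReal_le {Ω' E : Type*} [MeasurableSpace Ω'] [Finite E]
    (P : Measure Ω') [IsProbabilityMeasure P] {R : Ω' → Set E} (hR : IsRandomSubset R)
    (hP : IsPermutationInvariant P R) (Q : Set E → Prop) (N : ℕ → Prop) {ε : ℝ} (hε : 0 ≤ ε)
    (h : ∀ A : Set E, N A.ncard →
      (Nat.card {σ : Equiv.Perm E // Q (σ '' A)} : ℝ) ≤ ε * Nat.card (Equiv.Perm E)) :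
    P.real {ω | Q (R ω) ∧ N (R ω).ncard} ≤ ε := by
  classical
  have := Fintype.ofFinite E
  set F : ℝ := (Nat.card (Equiv.Perm E) : ℝ)
  have hF : 0 < F := by simp only [F]; exact_mod_cast Nat.card_pos
  rw [measureReal_setOf_eq_sum P hR (fun A => Q A ∧ N A.ncard)]
  -- Reindexing by `A ↦ σ '' A` preserves both the law and the cardinality. Summing over `σ` and
  -- exchanging sums leaves, for each fixed `A`, a pure count of permutations.
  have key : ∀ σ : Equiv.Perm E,
      (∑ A : Set E, if Q A ∧ N A.ncard then P.real {ω | R ω = A} else 0)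
      = ∑ A : Set E, if Q (σ '' A) ∧ N A.ncard then P.real {ω | R ω = A} else 0 := by
    intro σ
    rw [← Equiv.sum_comp (Equiv.Set.congr σ)]
    refine Finset.sum_congr rfl fun A _ => ?_
    have h1 : (Equiv.Set.congr σ) A = σ '' A := rfl
    have h2 : P.real {ω | R ω = σ '' A} = P.real {ω | R ω = A} := by
      rw [measureReal_def, hP σ A, measureReal_def]
    rw [h1, h2, Set.ncard_image_of_injective _ σ.injective]
  have htot : ∑ A : Set E, P.real {ω | R ω = A} = 1 := by
    have := measureReal_setOf_eq_sum P hR (fun _ => True)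
    simpa using this.symm
  have hsum : F * (∑ A : Set E, if Q A ∧ N A.ncard then P.real {ω | R ω = A} else 0)
      ≤ F * ε := by
    calc F * (∑ A : Set E, if Q A ∧ N A.ncard then P.real {ω | R ω = A} else 0)
        = ∑ σ : Equiv.Perm E,
          (∑ A : Set E, if Q A ∧ N A.ncard then P.real {ω | R ω = A} else 0) := by
          rw [Finset.sum_const, nsmul_eq_mul]
          simp only [F, Nat.card_eq_fintype_card, Finset.card_univ]
      _ = ∑ A : Set E, ∑ σ : Equiv.Perm E,
          if Q (σ '' A) ∧ N A.ncard then P.real {ω | R ω = A} else 0 := by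
          exact (Finset.sum_congr rfl fun σ _ => key σ).trans Finset.sum_comm
      _ ≤ ∑ A : Set E, (ε * F) * P.real {ω | R ω = A} := by
          refine Finset.sum_le_sum fun A _ => ?_
          by_cases hN : N A.ncard
          · simp only [hN, and_true]
            rw [← Finset.sum_filter, Finset.sum_const, nsmul_eq_mul]
            refine mul_le_mul_of_nonneg_right ?_ measureReal_nonneg
            have := h A hN
            rwa [Nat.card_eq_fintype_card, Fintype.card_subtype] at this
          · simp only [hN, and_false, if_false, Finset.sum_const_zero]
            positivity
      _ = F * ε := by rw [← Finset.mul_sum, htot]; ring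
  exact le_of_mul_le_mul_left hsum hF

theorem exists_perm_image_subset {E : Type*} [Fintype E] [DecidableEq E] {S T : Finset E}
    (h : S.card ≤ T.card) : ∃ σ : Equiv.Perm E, S.image σ ⊆ T := by
  obtain ⟨T', hT', hc⟩ := Finset.exists_subset_card_eq h
  have e : {x // x ∈ S} ≃ {x // x ∈ T'} := Fintype.equivOfCardEq (by simp [hc])
  refine ⟨e.extendSubtype, ?_⟩
  intro y hy
  obtain ⟨x, hx, rfl⟩ := Finset.mem_image.1 hy
  exact hT' (e.extendSubtype_mem x hx)

theorem exists_perm_image_eq {E : Type*} [Fintype E] [DecidableEq E] {S T : Finset E}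
    (h : S.card = T.card) : ∃ σ : Equiv.Perm E, S.image σ = T := by
  obtain ⟨σ, hσ⟩ := exists_perm_image_subset h.le
  refine ⟨σ, Finset.eq_of_subset_of_card_le hσ ?_⟩
  rw [Finset.card_image_of_injective _ σ.injective, h]

/-- The number of permutations that cover a given set `S` by the image of `A`. -/
theorem card_perm_subset_image_mul_choose {E : Type*} [Fintype E] [DecidableEq E]
    (S A : Finset E) :
    (univ.filter fun σ : Equiv.Perm E => S ⊆ A.image σ).card * (Fintype.card E).choose S.card
      = Fintype.card (Equiv.Perm E) * A.card.choose S.card := by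
  -- Left translation by a permutation taking `S` to `T` shows that the count depends only on the
  -- cardinality. The identity then follows by double counting pairs `(T, σ)`.
  have hconst : ∀ T ∈ powersetCard S.card (univ : Finset E),
      (univ.filter fun σ : Equiv.Perm E => T ⊆ A.image σ).card
        = (univ.filter fun σ : Equiv.Perm E => S ⊆ A.image σ).card := by
    intro T hT
    obtain ⟨τ, rfl⟩ := exists_perm_image_eq (S := S) (T := T) (mem_powersetCard.1 hT).2.symm
    refine (Finset.card_bij (fun σ _ => τ * σ) ?_ ?_ ?_).symm
    · intro σ hσ
      simp only [mem_filter, mem_univ, true_and] at hσ ⊢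
      have := Finset.image_subset_image (f := τ) hσ
      rwa [Finset.image_image] at this
    · intro σ _ σ' _ h
      exact mul_left_cancel h
    · intro σ hσ
      refine ⟨τ⁻¹ * σ, ?_, by simp⟩
      simp only [mem_filter, mem_univ, true_and] at hσ ⊢
      have := Finset.image_subset_image (f := (τ⁻¹ : Equiv.Perm E)) hσ
      rw [Finset.image_image, Finset.image_image] at this
      simpa [Function.comp_def] using this
  have h1 : ∑ T ∈ powersetCard S.card (univ : Finset E),
      (univ.filter fun σ : Equiv.Perm E => T ⊆ A.image σ).card
      = (Fintype.card E).choose S.card *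
        (univ.filter fun σ : Equiv.Perm E => S ⊆ A.image σ).card := by
    rw [Finset.sum_congr rfl hconst, sum_const, card_powersetCard, smul_eq_mul, card_univ]
  have h2 := Finset.sum_card_bipartiteAbove_eq_sum_card_bipartiteBelow
    (s := powersetCard S.card (univ : Finset E)) (t := (univ : Finset (Equiv.Perm E)))
    (fun T (σ : Equiv.Perm E) => T ⊆ A.image σ)
  have h3 : ∀ σ : Equiv.Perm E, (bipartiteBelow (fun T (σ : Equiv.Perm E) => T ⊆ A.image σ)
      (powersetCard S.card (univ : Finset E)) σ).card = A.card.choose S.card := by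
    intro σ
    rw [← Finset.card_image_of_injective A σ.injective, ← card_powersetCard]
    congr 1
    ext T
    simp [bipartiteBelow, mem_powersetCard, and_comm]
  rw [mul_comm, ← h1]
  simp only [bipartiteAbove] at h2
  rw [h2, Finset.sum_congr rfl fun σ _ => h3 σ]
  simp

/-- First moment estimate for configurations consisting of a set `T` of `k` elements and a further
element of `Bad T`. -/
theorem card_perm_exists_bad_le {E : Type*} [Fintype E] [DecidableEq E] (k Q : ℕ)
    (Bad : Finset E → Finset E) (hBad : ∀ T, T.card = k → (Bad T).card ≤ Q) (A : Finset E) :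
    (univ.filter fun σ : Equiv.Perm E => ∃ T ⊆ A.image σ, T.card = k ∧
      ∃ r ∈ A.image σ, r ∉ T ∧ r ∈ Bad T).card * (Fintype.card E - k)
      ≤ Fintype.card (Equiv.Perm E) * (Q * A.card ^ (k + 1)) := by
  set n := Fintype.card E
  set F := Fintype.card (Equiv.Perm E)
  rcases Nat.lt_or_ge k n with hk | hk
  swap
  · simp [Nat.sub_eq_zero_of_le hk]
  have hsub : (univ.filter fun σ : Equiv.Perm E => ∃ T ⊆ A.image σ, T.card = k ∧
      ∃ r ∈ A.image σ, r ∉ T ∧ r ∈ Bad T) ⊆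
      (powersetCard k (univ : Finset E)).biUnion fun T => ((Bad T) \ T).biUnion fun r =>
        univ.filter fun σ : Equiv.Perm E => insert r T ⊆ A.image σ := by
    intro σ hσ
    simp only [mem_filter, mem_univ, true_and] at hσ
    obtain ⟨T, hT, hc, r, hr, hrT, hrB⟩ := hσ
    simp only [mem_biUnion, mem_filter, mem_univ, true_and, mem_powersetCard]
    exact ⟨T, ⟨subset_univ _, hc⟩, r, mem_sdiff.2 ⟨hrB, hrT⟩, insert_subset hr hT⟩
  have hpos : 0 < n.choose k := Nat.choose_pos hk.le
  have hpos' : 0 < n.choose (k + 1) := Nat.choose_pos hk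
  have hch : n.choose (k + 1) * (k + 1) = n.choose k * (n - k) := Nat.choose_succ_right_eq n k
  have hbound : (univ.filter fun σ : Equiv.Perm E => ∃ T ⊆ A.image σ, T.card = k ∧
      ∃ r ∈ A.image σ, r ∉ T ∧ r ∈ Bad T).card * n.choose (k + 1)
      ≤ n.choose k * (Q * (F * A.card.choose (k + 1))) := by
    calc _ ≤ (∑ T ∈ powersetCard k (univ : Finset E), ∑ r ∈ (Bad T) \ T,
          (univ.filter fun σ : Equiv.Perm E => insert r T ⊆ A.image σ).card)
            * n.choose (k + 1) := by
          refine Nat.mul_le_mul_right _ ((card_le_card hsub).trans (card_biUnion_le.trans ?_))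
          exact sum_le_sum fun T _ => card_biUnion_le
      _ = ∑ T ∈ powersetCard k (univ : Finset E), ∑ r ∈ (Bad T) \ T,
            F * A.card.choose (k + 1) := by
          rw [sum_mul]
          refine sum_congr rfl fun T hT => ?_
          rw [sum_mul]
          refine sum_congr rfl fun r hr => ?_
          have := card_perm_subset_image_mul_choose (insert r T) A
          rw [card_insert_of_notMem (mem_sdiff.1 hr).2, (mem_powersetCard.1 hT).2] at this
          exact this
      _ ≤ ∑ T ∈ powersetCard k (univ : Finset E), Q * (F * A.card.choose (k + 1)) := by
          refine sum_le_sum fun T hT => ?_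
          rw [sum_const, smul_eq_mul]
          refine Nat.mul_le_mul_right _ ?_
          exact (card_le_card sdiff_subset).trans (hBad T (mem_powersetCard.1 hT).2)
      _ = _ := by simp [n]
  set X := (univ.filter fun σ : Equiv.Perm E => ∃ T ⊆ A.image σ, T.card = k ∧
      ∃ r ∈ A.image σ, r ∉ T ∧ r ∈ Bad T).card
  -- The quotient of `n.choose k` by `n.choose (k + 1)` leaves a factor `k + 1`, absorbed here into
  -- `A.card ^ (k + 1)`.
  have hfac : A.card.choose (k + 1) * (k + 1) ≤ A.card ^ (k + 1) := by
    calc A.card.choose (k + 1) * (k + 1) ≤ A.card.choose (k + 1) * (k + 1).factorial :=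
          Nat.mul_le_mul_left _ (Nat.self_le_factorial _)
      _ = A.card.descFactorial (k + 1) := by
          rw [Nat.descFactorial_eq_factorial_mul_choose, mul_comm]
      _ ≤ _ := Nat.descFactorial_le_pow _ _
  refine Nat.le_of_mul_le_mul_left ?_ hpos
  calc n.choose k * (X * (n - k)) = (X * n.choose (k + 1)) * (k + 1) := by
        rw [mul_assoc, hch]; ring
    _ ≤ n.choose k * (Q * (F * A.card.choose (k + 1))) * (k + 1) := Nat.mul_le_mul_right _ hbound
    _ = n.choose k * (F * (Q * (A.card.choose (k + 1) * (k + 1)))) := by ring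
    _ ≤ _ := by gcongr

/-- A monotone property fails for a random set of at least `2 M` elements at most as often as for
the union of two random samples of `M` elements. -/
theorem card_perm_not_mul_le {E : Type*} [Fintype E] [DecidableEq E] (M : ℕ)
    (X : Finset E → Prop) [DecidablePred X] (hX : ∀ S T, S ⊆ T → X S → X T) (A : Finset E)
    (hA : 2 * M ≤ A.card) :
    (univ.filter fun σ : Equiv.Perm E => ¬ X (A.image σ)).card * (Fintype.card E) ^ (2 * M)
      ≤ Fintype.card (Equiv.Perm E) *
        (univ.filter fun g : (Fin M → E) × (Fin M → E) =>
          ¬ X (univ.image g.1 ∪ univ.image g.2)).card := by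
  set C : (Fin M → E) × (Fin M → E) → Finset E := fun g => univ.image g.1 ∪ univ.image g.2
  -- The union of the two samples has at most `2 * M` elements, so some `τ` moves it into `A`. By
  -- monotonicity `σ ↦ σ * τ` sends failures for `A` to failures for the union.
  have h1 : ∀ g, (univ.filter fun σ : Equiv.Perm E => ¬ X (A.image σ)).card ≤
      (univ.filter fun σ : Equiv.Perm E => ¬ X ((C g).image σ)).card := by
    intro g
    have hC : (C g).card ≤ A.card := by
      refine (card_union_le _ _).trans ?_
      have h2 := card_image_le (s := (univ : Finset (Fin M))) (f := g.1)
      have h3 := card_image_le (s := (univ : Finset (Fin M))) (f := g.2)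
      simp only [card_univ, Fintype.card_fin] at h2 h3
      omega
    obtain ⟨τ, hτ⟩ := exists_perm_image_subset hC
    refine Finset.card_le_card_of_injOn (fun σ => σ * τ) ?_ ?_
    · intro σ hσ
      simp only [coe_filter, mem_univ, true_and, Set.mem_ofPred_eq] at hσ ⊢
      intro hx
      refine hσ (hX _ _ ?_ hx)
      have := Finset.image_subset_image (f := σ) hτ
      rwa [Finset.image_image] at this
    · intro σ _ σ' _ h
      exact mul_right_cancel h
  have h2 : ∀ σ : Equiv.Perm E,
      (univ.filter fun g : (Fin M → E) × (Fin M → E) => ¬ X ((C g).image σ)).card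
      = (univ.filter fun g : (Fin M → E) × (Fin M → E) => ¬ X (C g)).card := by
    intro σ
    refine Finset.card_bijective (fun g => (σ ∘ g.1, σ ∘ g.2)) ?_ ?_
    · exact (Equiv.prodCongr (Equiv.arrowCongr (Equiv.refl _) σ)
        (Equiv.arrowCongr (Equiv.refl _) σ)).bijective
    · intro g
      simp only [mem_filter, mem_univ, true_and, C, Finset.image_union, Finset.image_image]
  have h3 := Finset.sum_card_bipartiteAbove_eq_sum_card_bipartiteBelow
    (s := (univ : Finset (Equiv.Perm E))) (t := (univ : Finset ((Fin M → E) × (Fin M → E))))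
    (fun (σ : Equiv.Perm E) g => ¬ X ((C g).image σ))
  simp only [bipartiteAbove, bipartiteBelow] at h3
  rw [sum_congr rfl fun σ _ => h2 σ, sum_const, smul_eq_mul, card_univ] at h3
  rw [h3]
  calc _ = ∑ g : (Fin M → E) × (Fin M → E),
        (univ.filter fun σ : Equiv.Perm E => ¬ X (A.image σ)).card := by
        rw [sum_const, smul_eq_mul, card_univ, Fintype.card_prod, Fintype.card_fun,
          Fintype.card_fin, mul_comm, two_mul, pow_add]
    _ ≤ _ := sum_le_sum fun g _ => h1 g

end Averaging

/-! ### Counting reduced words and positive-ended words. -/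

section WordCounts

open Finset

variable {m : ℕ}

/-- The reduced words of length `k` that can follow the letter `x`. -/
def continuations (x : Fin m × Bool) : ℕ → Finset (GWord m)
  | 0 => {[]}
  | k + 1 => ((univ : Finset (Fin m × Bool)).erase (x.1, !x.2)).biUnion fun y =>
      (continuations y k).image (List.cons y)

theorem follows_iff {x y : Fin m × Bool} : (x.1 = y.1 → x.2 = y.2) ↔ y ≠ (x.1, !x.2) := by
  obtain ⟨a, b⟩ := x
  obtain ⟨c, d⟩ := y
  cases b <;> cases d <;> simp [Prod.ext_iff, eq_comm]

theorem mem_continuations {x : Fin m × Bool} {k : ℕ} {w : GWord m} :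
    w ∈ continuations x k ↔ w.length = k ∧ FreeGroup.IsReduced (x :: w) := by
  induction k generalizing x w with
  | zero =>
    simp only [continuations, mem_singleton, List.length_eq_zero_iff]
    constructor
    · rintro rfl; simp
    · exact fun h => h.1
  | succ k ih =>
    simp only [continuations, mem_biUnion, mem_erase, mem_univ, and_true, mem_image]
    constructor
    · rintro ⟨y, hy, w', hw', rfl⟩
      obtain ⟨h1, h2⟩ := ih.1 hw'
      exact ⟨by simp [h1], FreeGroup.isReduced_cons_cons.2 ⟨follows_iff.2 hy, h2⟩⟩
    · rintro ⟨h1, h2⟩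
      obtain _ | ⟨y, w'⟩ := w
      · simp at h1
      · rw [FreeGroup.isReduced_cons_cons] at h2
        exact ⟨y, follows_iff.1 h2.1, w', ih.2 ⟨by simpa using h1, h2.2⟩, rfl⟩

theorem card_continuations (x : Fin m × Bool) (k : ℕ) :
    (continuations x k).card = (2 * m - 1) ^ k := by
  induction k generalizing x with
  | zero => simp [continuations]
  | succ k ih =>
    rw [continuations, card_biUnion]
    · have : ∀ y ∈ (univ : Finset (Fin m × Bool)).erase (x.1, !x.2),
          ((continuations y k).image (List.cons y)).card = (2 * m - 1) ^ k := by
        intro y _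
        rw [card_image_of_injective _ List.cons_injective, ih]
      rw [sum_congr rfl this, sum_const, card_erase_of_mem (mem_univ _), card_univ,
        Fintype.card_prod, Fintype.card_fin, Fintype.card_bool, smul_eq_mul, pow_succ,
        mul_comm m 2, mul_comm]
    · intro y _ z _ hyz
      rw [Function.onFun, Finset.disjoint_left]
      intro w hw hw'
      obtain ⟨_, _, rfl⟩ := mem_image.1 hw
      obtain ⟨_, _, h⟩ := mem_image.1 hw'
      exact hyz (List.cons.inj h).1.symm

/-- The reduced words of length `k`. -/
def reducedWords (m : ℕ) : ℕ → Finset (GWord m)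
  | 0 => {[]}
  | k + 1 => (univ : Finset (Fin m × Bool)).biUnion fun y => (continuations y k).image (List.cons y)

theorem mem_reducedWords {k : ℕ} {w : GWord m} :
    w ∈ reducedWords m k ↔ w.length = k ∧ FreeGroup.IsReduced w := by
  cases k with
  | zero =>
    simp only [reducedWords, mem_singleton, List.length_eq_zero_iff]
    constructor
    · rintro rfl; simp
    · exact fun h => h.1
  | succ k =>
    simp only [reducedWords, mem_biUnion, mem_univ, true_and, mem_image, mem_continuations]
    constructor
    · rintro ⟨y, w', ⟨h1, h2⟩, rfl⟩
      exact ⟨by simp [h1], h2⟩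
    · rintro ⟨h1, h2⟩
      obtain _ | ⟨y, w'⟩ := w
      · simp at h1
      · exact ⟨y, w', ⟨by simpa using h1, h2⟩, rfl⟩

theorem card_reducedWords_le (m k : ℕ) : (reducedWords m k).card ≤ 2 * (2 * m - 1) ^ k := by
  cases k with
  | zero => simp [reducedWords]
  | succ k =>
    refine card_biUnion_le.trans ?_
    calc _ ≤ ∑ y : Fin m × Bool, (2 * m - 1) ^ k :=
          sum_le_sum fun y _ => card_image_le.trans (card_continuations y k).le
      _ = (m * 2) * (2 * m - 1) ^ k := by simp
      _ ≤ (2 * (2 * m - 1)) * (2 * m - 1) ^ k := by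
          refine Nat.mul_le_mul_right _ ?_
          omega
      _ = _ := by ring

/-- A reduced word is positive-ended when it begins with `x₁` and does not end with
the inverse of `x₁`; such words can be concatenated without cancellation. -/
def IsPositiveEnded (hm : 0 < m) (w : GWord m) : Prop :=
  FreeGroup.IsReduced w ∧ w.head? = some (⟨0, hm⟩, true) ∧ w.getLast? ≠ some (⟨0, hm⟩, false)

theorem IsPositiveEnded.ne_nil {hm : 0 < m} {w : GWord m} (h : IsPositiveEnded hm w) : w ≠ [] := by
  rintro rfl
  simpa using h.2.1

theorem IsPositiveEnded.append {hm : 0 < m} {w v : GWord m} (hw : IsPositiveEnded hm w)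
    (hv : IsPositiveEnded hm v) : IsPositiveEnded hm (w ++ v) := by
  refine ⟨?_, ?_, ?_⟩
  · refine List.isChain_append.2 ⟨hw.1, hv.1, ?_⟩
    intro x hx y hy
    rw [hv.2.1, Option.mem_some_iff] at hy
    subst hy
    have h := hw.2.2
    rw [Option.mem_def] at hx
    rw [hx] at h
    obtain ⟨a, b⟩ := x
    cases b
    · rintro rfl
      exact absurd rfl h
    · simp
  · rw [List.head?_append_of_ne_nil _ hw.ne_nil, hw.2.1]
  · rw [List.getLast?_append_of_ne_nil _ hv.ne_nil]
    exact hv.2.2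

theorem IsPositiveEnded.isCyclicallyReduced {hm : 0 < m} {w : GWord m}
    (hw : IsPositiveEnded hm w) : FreeGroup.IsCyclicallyReduced w := by
  refine ⟨hw.1, ?_⟩
  intro x hx y hy
  have := (hw.append hw).1
  exact (List.isChain_append.1 this).2.2 x hx y hy

open Classical in
/-- The positive-ended words of length `k`. -/
noncomputable def positiveWords (hm : 0 < m) (k : ℕ) : Finset (GWord m) :=
  (reducedWords m k).filter (IsPositiveEnded hm)

theorem mem_positiveWords {hm : 0 < m} {k : ℕ} {w : GWord m} :
    w ∈ positiveWords hm k ↔ w.length = k ∧ IsPositiveEnded hm w := by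
  simp only [positiveWords, mem_filter, mem_reducedWords, and_assoc]
  exact ⟨fun h => ⟨h.1, h.2.2⟩, fun h => ⟨h.1, h.2.1, h.2⟩⟩

/-- The first letter is prescribed and the next `k` are free continuations. The last letter must
avoid only the inverse of its predecessor and the inverse of `x₁`, which is possible because there
are at least four letters. -/
theorem pow_le_card_positiveWords (hm : 2 ≤ m) (k : ℕ) :
    (2 * m - 1) ^ k ≤ (positiveWords (Nat.zero_lt_of_lt hm) (k + 2)).card := by
  set a : Fin m × Bool := (⟨0, Nat.zero_lt_of_lt hm⟩, true)
  rw [← card_continuations a k]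
  have hne : ∀ x : Fin m × Bool, ∃ y : Fin m × Bool, (x.1 = y.1 → x.2 = y.2) ∧ y ≠ (a.1, !a.2) := by
    intro x
    have : (({(x.1, !x.2), (a.1, !a.2)} : Finset (Fin m × Bool))).card
        < (univ : Finset (Fin m × Bool)).card := by
      refine (card_insert_le _ _).trans_lt ?_
      rw [card_univ, Fintype.card_prod, Fintype.card_fin, Fintype.card_bool, card_singleton]
      omega
    obtain ⟨y, -, hy⟩ := Finset.exists_mem_notMem_of_card_lt_card this
    simp only [mem_insert, mem_singleton, not_or] at hy
    exact ⟨y, follows_iff.2 hy.1, hy.2⟩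
  choose f hf using hne
  refine Finset.card_le_card_of_injOn
    (fun w => (a :: w) ++ [f ((a :: w).getLast (List.cons_ne_nil _ _))]) ?_ ?_
  · intro w hw
    obtain ⟨h1, h2⟩ := mem_continuations.1 (mem_coe.1 hw)
    refine mem_coe.2 (mem_positiveWords.2 ⟨by simp [h1], ?_, by simp [a], ?_⟩)
    · refine List.isChain_append.2 ⟨h2, by simp, ?_⟩
      intro x hx y hy
      rw [List.getLast?_eq_getLast_of_ne_nil (List.cons_ne_nil _ _), Option.mem_some_iff] at hx
      simp only [List.head?_cons, Option.mem_some_iff] at hy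
      rw [← hy, ← hx]
      exact (hf _).1
    · rw [List.getLast?_append_of_ne_nil _ (by simp), List.getLast?_singleton]
      intro h
      exact (hf _).2 (Option.some.inj h)
  · intro w _ w' _ h
    have := (List.append_inj' h rfl).1
    exact (List.cons.inj this).2

end WordCounts

/-! ### Cyclic permutations, inverses and cyclic subwords. -/

section Symmetrization

open Finset

variable {m : ℕ}

theorem isRotated_invRev {w v : GWord m} (h : w.IsRotated v) :
    (FreeGroup.invRev w).IsRotated (FreeGroup.invRev v) :=
  (h.map _).reverse

theorem isRotated_invRev_comm {w v : GWord m} :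
    w.IsRotated (FreeGroup.invRev v) ↔ (FreeGroup.invRev w).IsRotated v := by
  constructor <;> intro h
  · simpa using isRotated_invRev h
  · simpa using isRotated_invRev h

theorem mem_symmetrized_singleton {r w : GWord m} :
    w ∈ symmetrized {r} ↔ w.IsRotated r ∨ w.IsRotated (FreeGroup.invRev r) := by
  simp [symmetrized]

theorem mem_symmetrized_iff {R : Set (GWord m)} {w : GWord m} :
    w ∈ symmetrized R ↔ ∃ r ∈ R, w ∈ symmetrized {r} := by
  simp [symmetrized]

theorem mem_symmetrized_singleton_comm {r w : GWord m} :
    w ∈ symmetrized {r} ↔ r ∈ symmetrized {w} := by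
  rw [mem_symmetrized_singleton, mem_symmetrized_singleton, isRotated_invRev_comm,
    List.isRotated_comm, List.isRotated_comm (l := FreeGroup.invRev w)]

theorem symmetrized_singleton_of_isRotated {r w v : GWord m} (h : v.IsRotated w)
    (hw : w ∈ symmetrized {r}) : v ∈ symmetrized {r} := by
  rw [mem_symmetrized_singleton] at hw ⊢
  exact hw.imp h.trans h.trans

theorem isRotated_or_of_mem_symmetrized {r w v : GWord m} (hw : w ∈ symmetrized {r})
    (hv : v ∈ symmetrized {r}) : w.IsRotated v ∨ w.IsRotated (FreeGroup.invRev v) := by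
  rw [mem_symmetrized_singleton] at hw hv
  rcases hw with hw | hw <;> rcases hv with hv | hv
  · exact Or.inl (hw.trans hv.symm)
  · exact Or.inr (hw.trans (isRotated_invRev_comm.1 hv).symm)
  · exact Or.inr (hw.trans (isRotated_invRev hv).symm)
  · exact Or.inl (hw.trans hv.symm)

theorem length_eq_of_mem_symmetrized {r w : GWord m} (hw : w ∈ symmetrized {r}) :
    w.length = r.length := by
  rcases mem_symmetrized_singleton.1 hw with h | h
  · exact h.perm.length_eq
  · simpa using h.perm.length_eq

theorem isCyclicallyReduced_iff_isReduced_append {w : GWord m} :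
    FreeGroup.IsCyclicallyReduced w ↔ FreeGroup.IsReduced (w ++ w) := by
  rw [FreeGroup.isCyclicallyReduced_iff, FreeGroup.IsReduced, FreeGroup.IsReduced,
    List.isChain_append]
  exact ⟨fun h => ⟨h.1, h.1, h.2⟩, fun h => ⟨h.1, h.2.2⟩⟩

/-- Cyclic reducedness of `w` means that `w ++ w` is reduced. Then `w ++ w ++ w` is reduced too, and
it contains the square of every rotation of `w`. -/
theorem FreeGroup.IsCyclicallyReduced.of_isRotated {w v : GWord m}
    (h : FreeGroup.IsCyclicallyReduced w) (hv : w.IsRotated v) :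
    FreeGroup.IsCyclicallyReduced v := by
  rcases eq_or_ne w [] with rfl | hne
  · rw [List.isRotated_nil_iff'] at hv
    exact hv ▸ h
  obtain ⟨n, hn, rfl⟩ := List.isRotated_iff_mod.1 hv
  rw [isCyclicallyReduced_iff_isReduced_append] at h ⊢
  have h3 : FreeGroup.IsReduced (w ++ w ++ w) := h.append_overlap h hne
  refine h3.infix ⟨w.take n, w.drop n, ?_⟩
  rw [List.rotate_eq_drop_append_take hn]
  have := List.take_append_drop n w
  calc _ = (w.take n ++ w.drop n) ++ (w.take n ++ w.drop n) ++ (w.take n ++ w.drop n) := by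
        simp only [List.append_assoc]
    _ = _ := by rw [this]

theorem isReduced_invRev {w : GWord m} (h : FreeGroup.IsReduced w) :
    FreeGroup.IsReduced (FreeGroup.invRev w) := by
  rw [FreeGroup.isReduced_iff_reduce_eq] at h ⊢
  rw [FreeGroup.reduce_invRev, h]

theorem FreeGroup.IsCyclicallyReduced.of_mem_symmetrized {r w : GWord m}
    (h : FreeGroup.IsCyclicallyReduced r) (hw : w ∈ symmetrized {r}) :
    FreeGroup.IsCyclicallyReduced w := by
  rcases mem_symmetrized_singleton.1 hw with hw | hw
  · exact h.of_isRotated hw.symm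
  · refine FreeGroup.IsCyclicallyReduced.of_isRotated (w := FreeGroup.invRev r) ?_ hw.symm
    rw [isCyclicallyReduced_iff_isReduced_append] at h ⊢
    rw [← FreeGroup.invRev_append]
    exact isReduced_invRev h

/-- Free groups have no 2-torsion. This excludes a subword overlapping its own inverse. -/
theorem eq_nil_of_eq_invRev {w : GWord m} (h : FreeGroup.IsReduced w)
    (hw : w = FreeGroup.invRev w) : w = [] := by
  have h1 : (FreeGroup.mk w) ^ 2 = 1 := by
    rw [pow_two]
    nth_rewrite 2 [hw]
    rw [← FreeGroup.inv_mk, mul_inv_cancel]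
  have h2 : FreeGroup.mk w = 1 := by
    exact (pow_eq_one_iff_left two_ne_zero).1 h1
  have h3 := congrArg FreeGroup.toWord h2
  rwa [FreeGroup.toWord_mk, h.reduce_eq, FreeGroup.toWord_one] at h3

/-- The symmetrization of a finite set of words. -/
def symmetrization (T : Finset (GWord m)) : Finset (GWord m) :=
  T.biUnion fun r => (range (r.length + 1)).image r.rotate ∪
    (range (r.length + 1)).image (FreeGroup.invRev r).rotate

theorem mem_symmetrization {T : Finset (GWord m)} {w : GWord m} :
    w ∈ symmetrization T ↔ ∃ r ∈ T, w ∈ symmetrized {r} := by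
  have h : ∀ r v : GWord m, w.IsRotated r ↔ ∃ n < r.length + 1, r.rotate n = w := by
    intro r _
    rw [List.isRotated_comm, List.isRotated_iff_mod]
    simp only [Nat.lt_succ_iff]
  simp only [symmetrization, mem_biUnion, mem_union, mem_image, Finset.mem_range,
    mem_symmetrized_singleton]
  refine exists_congr fun r => and_congr_right fun _ => ?_
  rw [h r r, h (FreeGroup.invRev r) r, FreeGroup.invRev_length]

theorem card_symmetrization_le {T : Finset (GWord m)} {ℓ : ℕ} (h : ∀ r ∈ T, r.length ≤ ℓ) :
    (symmetrization T).card ≤ T.card * (2 * (ℓ + 1)) := by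
  refine card_biUnion_le_card_mul _ _ _ fun r hr => ?_
  refine (card_union_le _ _).trans ?_
  have h1 := card_image_le (s := range (r.length + 1)) (f := r.rotate)
  have h2 := card_image_le (s := range (r.length + 1)) (f := (FreeGroup.invRev r).rotate)
  rw [card_range] at h1 h2
  have := h r hr
  omega

/-- The cyclic subwords of the words in `T` and their inverses. -/
def cyclicSubwords (T : Finset (GWord m)) : Finset (GWord m) :=
  (symmetrization T).biUnion fun w => w.inits.toFinset

theorem mem_cyclicSubwords {T : Finset (GWord m)} {u : GWord m} :
    u ∈ cyclicSubwords T ↔ ∃ r ∈ T, ∃ w ∈ symmetrized {r}, u <+: w := by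
  simp only [cyclicSubwords, mem_biUnion, mem_symmetrization, List.mem_toFinset, List.mem_inits]
  constructor
  · rintro ⟨w, ⟨r, hr, hw⟩, hu⟩
    exact ⟨r, hr, w, hw, hu⟩
  · rintro ⟨r, hr, w, hw, hu⟩
    exact ⟨w, ⟨r, hr, hw⟩, hu⟩

theorem card_cyclicSubwords_le {T : Finset (GWord m)} {ℓ : ℕ} (h : ∀ r ∈ T, r.length ≤ ℓ) :
    (cyclicSubwords T).card ≤ T.card * (2 * (ℓ + 1)) * (ℓ + 1) := by
  refine (card_biUnion_le_card_mul _ _ (ℓ + 1) fun w hw => ?_).trans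
    (Nat.mul_le_mul_right _ (card_symmetrization_le h))
  obtain ⟨r, hr, hw⟩ := mem_symmetrization.1 hw
  refine (List.toFinset_card_le _).trans ?_
  rw [List.length_inits, length_eq_of_mem_symmetrized hw]
  exact Nat.succ_le_succ (h r hr)

end Symmetrization

/-! ### Counting words covered by prescribed subwords. -/

section CoveredWords

open Finset

variable {m : ℕ}

/-- The total length of the words of the list `L` that belong to `V`. -/
def totalLengthIn (V : Finset (GWord m)) (L : List (GWord m)) : ℕ :=
  ((L.filter (· ∈ V)).map List.length).sum

theorem totalLengthIn_nil (V : Finset (GWord m)) : totalLengthIn V [] = 0 := rfl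

theorem totalLengthIn_cons (V : Finset (GWord m)) (u : GWord m) (L : List (GWord m)) :
    totalLengthIn V (u :: L) = (if u ∈ V then u.length else 0) + totalLengthIn V L := by
  by_cases h : u ∈ V <;> simp [totalLengthIn, h]

theorem totalLengthIn_mono {V V' : Finset (GWord m)} (h : V ⊆ V') (L : List (GWord m)) :
    totalLengthIn V L ≤ totalLengthIn V' L := by
  induction L with
  | nil => simp [totalLengthIn_nil]
  | cons u L ih =>
    rw [totalLengthIn_cons, totalLengthIn_cons]
    refine Nat.add_le_add ?_ ih
    by_cases hu : u ∈ V
    · simp [hu, h hu]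
    · simp [hu]

open Classical in
/-- The reduced words of length `n` with an initial segment that is a product of at most `q` words,
of which those in `V` have total length at least `f`. -/
noncomputable def coveredWords (V : Finset (GWord m)) (q n f : ℕ) : Finset (GWord m) :=
  (reducedWords m n).filter fun w => ∃ L : List (GWord m), L.length ≤ q ∧ L.flatten <+: w ∧
    f ≤ totalLengthIn V L

theorem mem_coveredWords {V : Finset (GWord m)} {q n f : ℕ} {w : GWord m} :
    w ∈ coveredWords V q n f ↔ (w.length = n ∧ FreeGroup.IsReduced w) ∧
      ∃ L : List (GWord m), L.length ≤ q ∧ L.flatten <+: w ∧ f ≤ totalLengthIn V L := by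
  classical
  rw [coveredWords, mem_filter, mem_reducedWords]

/-- The first factor is split off: if it lies in `V`, its length is deducted from `f`; otherwise it
is an arbitrary reduced word and `f` stays. An empty product is put in the second case with an empty
factor. -/
theorem coveredWords_succ_subset (V : Finset (GWord m)) (q n f : ℕ) :
    coveredWords V (q + 1) n f ⊆
      ((V.filter fun v => v.length ≤ n).biUnion fun v =>
        (coveredWords V q (n - v.length) (f - v.length)).image fun t => v ++ t) ∪
      (range (n + 1)).biUnion fun l =>
        (reducedWords m l ×ˢ coveredWords V q (n - l) f).image fun t => t.1 ++ t.2 := by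
  intro w hw
  obtain ⟨⟨hlen, hred⟩, L, hL, hpre, hf⟩ := mem_coveredWords.1 hw
  rw [mem_union]
  obtain _ | ⟨u, L⟩ := L
  · right
    rw [mem_biUnion]
    refine ⟨0, by simp, mem_image.2 ⟨([], w), mem_product.2 ⟨?_, ?_⟩, rfl⟩⟩
    · simp [reducedWords]
    · exact mem_coveredWords.2 ⟨⟨hlen, hred⟩, [], by simp, by simp, hf⟩
  · rw [List.flatten_cons] at hpre
    obtain ⟨t, rfl⟩ := (List.prefix_append u L.flatten).trans hpre
    rw [List.prefix_append_right_inj] at hpre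
    rw [totalLengthIn_cons] at hf
    rw [List.length_append] at hlen
    have ht : FreeGroup.IsReduced t := hred.infix (List.suffix_append u t).isInfix
    have hu : FreeGroup.IsReduced u := hred.infix (List.prefix_append u t).isInfix
    have hL' : L.length ≤ q := by simpa using hL
    by_cases huV : u ∈ V
    · left
      rw [if_pos huV] at hf
      refine mem_biUnion.2 ⟨u, mem_filter.2 ⟨huV, by omega⟩, mem_image.2 ⟨t, ?_, rfl⟩⟩
      exact mem_coveredWords.2 ⟨⟨by omega, ht⟩, L, hL', hpre, by omega⟩
    · right
      rw [if_neg huV] at hf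
      refine mem_biUnion.2 ⟨u.length, by simp; omega, mem_image.2 ⟨(u, t), ?_, rfl⟩⟩
      exact mem_product.2 ⟨mem_reducedWords.2 ⟨rfl, hu⟩,
        mem_coveredWords.2 ⟨⟨by simp only; omega, ht⟩, L, hL', hpre, by omega⟩⟩

/-- Each letter covered by a word of `V` saves a factor `2 * m - 1`. Each factor costs only a choice
in `V` or a choice of a length, with an extra 2 from `card_reducedWords_le`. The bound `N` is kept
apart from `n` because `n` shrinks in the induction. -/
theorem card_coveredWords_mul_le (hm : 0 < m) (V : Finset (GWord m)) (q N n f : ℕ) (hn : n ≤ N) :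
    (coveredWords V q n f).card * (2 * m - 1) ^ f
      ≤ 2 * (V.card + 2 * (N + 1)) ^ q * (2 * m - 1) ^ n := by
  have hb : 0 < 2 * m - 1 := by omega
  set b := 2 * m - 1
  induction q generalizing n f with
  | zero =>
    rcases Nat.eq_zero_or_pos f with rfl | hf
    · simp only [pow_zero, mul_one]
      refine (card_le_card fun w hw => ?_).trans (card_reducedWords_le m n)
      exact mem_reducedWords.2 (mem_coveredWords.1 hw).1
    · have : coveredWords V 0 n f = ∅ := by
        rw [eq_empty_iff_forall_notMem]
        intro w hw
        obtain ⟨-, L, hL, -, h⟩ := mem_coveredWords.1 hw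
        obtain rfl : L = [] := by simpa using hL
        rw [totalLengthIn_nil] at h
        omega
      simp [this]
  | succ q ih =>
    set C := 2 * (V.card + 2 * (N + 1)) ^ q
    have h1 : ((V.filter fun v => v.length ≤ n).biUnion fun v =>
        (coveredWords V q (n - v.length) (f - v.length)).image fun t => v ++ t).card * b ^ f
        ≤ V.card * (C * b ^ n) := by
      refine (Nat.mul_le_mul_right _ card_biUnion_le).trans ?_
      rw [sum_mul]
      refine (sum_le_card_nsmul _ _ (C * b ^ n) fun v hv => ?_).trans ?_
      -- Truncation in `f - v.length` is harmless: only `f ≤ (f - v.length) + v.length` is used.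
      · have hv' := (mem_filter.1 hv).2
        calc _ ≤ (coveredWords V q (n - v.length) (f - v.length)).card *
              (b ^ (f - v.length) * b ^ v.length) := by
              refine Nat.mul_le_mul card_image_le ?_
              rw [← pow_add]
              exact Nat.pow_le_pow_right hb (by omega)
          _ = (coveredWords V q (n - v.length) (f - v.length)).card * b ^ (f - v.length) *
              b ^ v.length := by ring
          _ ≤ C * b ^ (n - v.length) * b ^ v.length := Nat.mul_le_mul_right _ (ih _ _ (by omega))
          _ = C * b ^ n := by rw [mul_assoc, ← pow_add, Nat.sub_add_cancel hv']
      · rw [smul_eq_mul]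
        exact Nat.mul_le_mul_right _ (card_filter_le _ _)
    have h2 : ((range (n + 1)).biUnion fun l =>
        (reducedWords m l ×ˢ coveredWords V q (n - l) f).image fun t => t.1 ++ t.2).card * b ^ f
        ≤ (N + 1) * (2 * (C * b ^ n)) := by
      refine (Nat.mul_le_mul_right _ card_biUnion_le).trans ?_
      rw [sum_mul]
      refine (sum_le_card_nsmul _ _ (2 * (C * b ^ n)) fun l hl => ?_).trans ?_
      · have hl' : l ≤ n := by simpa [Nat.lt_succ_iff] using hl
        calc _ ≤ ((reducedWords m l).card * (coveredWords V q (n - l) f).card) * b ^ f := by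
              refine Nat.mul_le_mul_right _ (card_image_le.trans ?_)
              rw [card_product]
          _ ≤ (2 * b ^ l * (coveredWords V q (n - l) f).card) * b ^ f := by
              gcongr
              exact card_reducedWords_le m l
          _ = 2 * b ^ l * ((coveredWords V q (n - l) f).card * b ^ f) := by ring
          _ ≤ 2 * b ^ l * (C * b ^ (n - l)) := Nat.mul_le_mul_left _ (ih _ _ (by omega))
          _ = 2 * (C * (b ^ (n - l) * b ^ l)) := by ring
          _ = 2 * (C * b ^ n) := by rw [← pow_add, Nat.sub_add_cancel hl']
      · rw [smul_eq_mul, card_range]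
        exact Nat.mul_le_mul_right _ (by omega)
    calc _ ≤ _ := Nat.mul_le_mul_right _
          ((card_le_card (coveredWords_succ_subset V q n f)).trans (card_union_le _ _))
      _ ≤ V.card * (C * b ^ n) + (N + 1) * (2 * (C * b ^ n)) := by
          rw [add_mul]
          exact add_le_add h1 h2
      _ = C * (V.card + 2 * (N + 1)) * b ^ n := by ring
      _ = _ := by simp only [C]; ring

end CoveredWords

/-! ### Words that overlap a shifted copy of themselves or of their inverse. -/

section SelfOverlap

open Finset

variable {m : ℕ}

/-- The word `w` has a subword of length `f`, preceded by `y`, that is determined by `y`: it repeats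
an earlier subword, or it is inverse to the beginning of `w`. -/
def HasOverlap (f : ℕ) (w : GWord m) : Prop :=
  ∃ y z t : GWord m, w = y ++ z ++ t ∧ z.length = f ∧
    ((y ≠ [] ∧ z <+: y ++ z) ∨ z = FreeGroup.invRev (y.take f))

/-- The hypothesis makes `z` periodic with period `y`, so `y` and the length determine it letter by
letter. -/
theorem eq_of_isPrefix_append {α : Type*} {y z z' : List α} (hy : y ≠ []) (hz : z <+: y ++ z)
    (hz' : z' <+: y ++ z') (h : z.length = z'.length) : z = z' := by
  have key : ∀ i (hi : i < z.length) (hi' : i < z'.length), z[i] = z'[i] := by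
    intro i
    induction i using Nat.strong_induction_on with
    | _ i ih =>
      intro hi hi'
      rw [hz.getElem hi, hz'.getElem hi']
      have hpos := List.length_pos_of_ne_nil hy
      by_cases hc : i < y.length
      · rw [List.getElem_append_left hc, List.getElem_append_left hc]
      · rw [List.getElem_append_right (not_lt.1 hc), List.getElem_append_right (not_lt.1 hc)]
        exact ih _ (by omega) _ _
  exact List.ext_getElem h fun i h1 h2 => key i h1 h2

open Classical in
/-- The reduced words of length `n` with an overlap of length `f`. -/
noncomputable def overlapWords (m n f : ℕ) : Finset (GWord m) :=
  (reducedWords m n).filter (HasOverlap f)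

theorem mem_overlapWords {n f : ℕ} {w : GWord m} :
    w ∈ overlapWords m n f ↔ (w.length = n ∧ FreeGroup.IsReduced w) ∧ HasOverlap f w := by
  classical
  rw [overlapWords, mem_filter, mem_reducedWords]

/-- For a given type and position of the overlap, the word is determined by the parts before and
after `z`, so `f` letters are lost. There are at most `n + 1` positions and two types. -/
theorem card_overlapWords_mul_le (m n f : ℕ) :
    (overlapWords m n f).card * (2 * m - 1) ^ f ≤ 8 * (n + 1) * (2 * m - 1) ^ n := by
  classical
  set b := 2 * m - 1
  let S₁ : ℕ → Finset (GWord m) := fun c => (reducedWords m n).filter fun w =>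
    ∃ y z t : GWord m, w = y ++ z ++ t ∧ z.length = f ∧ y.length = c ∧ y ≠ [] ∧ z <+: y ++ z
  let S₂ : ℕ → Finset (GWord m) := fun c => (reducedWords m n).filter fun w =>
    ∃ y z t : GWord m, w = y ++ z ++ t ∧ z.length = f ∧ y.length = c ∧
      z = FreeGroup.invRev (y.take f)
  have hsub : overlapWords m n f ⊆ (range (n + 1)).biUnion fun c => S₁ c ∪ S₂ c := by
    intro w hw
    obtain ⟨⟨hlen, hred⟩, y, z, t, rfl, hz, h⟩ := mem_overlapWords.1 hw
    refine mem_biUnion.2 ⟨y.length, ?_, mem_union.2 ?_⟩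
    · simp only [List.length_append] at hlen
      simp only [Finset.mem_range]
      omega
    · have hmem := mem_reducedWords.2 ⟨hlen, hred⟩
      rcases h with ⟨hy, hp⟩ | h
      · exact Or.inl (mem_filter.2 ⟨hmem, y, z, t, rfl, hz, rfl, hy, hp⟩)
      · exact Or.inr (mem_filter.2 ⟨hmem, y, z, t, rfl, hz, rfl, h⟩)
  have hpair : ∀ c (S : Finset (GWord m)), S ⊆ reducedWords m n →
      (∀ w ∈ S, ∃ y z t : GWord m, w = y ++ z ++ t ∧ z.length = f ∧ y.length = c) →
      (∀ y z t z' : GWord m, ∀ t', y ++ z ++ t ∈ S → y ++ z' ++ t' ∈ S → z.length = f →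
        z'.length = f → y.length = c → z = z') →
      S.card * b ^ f ≤ 4 * b ^ n := by
    intro c S hS hdec hinj
    rcases S.eq_empty_or_nonempty with rfl | ⟨w₀, hw₀⟩
    · simp
    have hcf : c + f ≤ n := by
      obtain ⟨y, z, t, rfl, hz, hy⟩ := hdec w₀ hw₀
      have := (mem_reducedWords.1 (hS hw₀)).1
      simp only [List.length_append] at this
      omega
    have hcard : S.card ≤ (reducedWords m c ×ˢ reducedWords m (n - c - f)).card := by
      refine Finset.card_le_card_of_injOn (fun w => (w.take c, w.drop (c + f))) ?_ ?_
      · intro w hw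
        obtain ⟨hlen, hred⟩ := mem_reducedWords.1 (hS hw)
        refine mem_coe.2 (mem_product.2 ⟨mem_reducedWords.2 ⟨?_, ?_⟩, mem_reducedWords.2 ⟨?_, ?_⟩⟩)
        · simp only [List.length_take]; omega
        · exact hred.infix (List.take_prefix _ _).isInfix
        · simp only [List.length_drop]; omega
        · exact hred.infix (List.drop_suffix _ _).isInfix
      · intro w hw w' hw' h
        obtain ⟨y, z, t, rfl, hz, hy⟩ := hdec w hw
        obtain ⟨y', z', t', rfl, hz', hy'⟩ := hdec w' hw'
        obtain ⟨h1, h2⟩ := Prod.mk.inj h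
        have hl : (y ++ z).length = c + f := by simp [hz, hy]
        have hl' : (y' ++ z').length = c + f := by simp [hz', hy']
        rw [List.drop_left' hl, List.drop_left' hl'] at h2
        rw [List.append_assoc, List.append_assoc, List.take_left' hy, List.take_left' hy'] at h1
        subst h1 h2
        rw [hinj y z t z' t hw hw' hz hz' hy]
    calc S.card * b ^ f ≤ (2 * b ^ c * (2 * b ^ (n - c - f))) * b ^ f := by
          refine Nat.mul_le_mul_right _ (hcard.trans ?_)
          rw [card_product]
          exact Nat.mul_le_mul (card_reducedWords_le m c) (card_reducedWords_le m _)
      _ = 4 * b ^ (c + (n - c - f) + f) := by ring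
      _ = 4 * b ^ n := by congr 2; omega
  have h₁ : ∀ c, (S₁ c).card * b ^ f ≤ 4 * b ^ n := by
    intro c
    refine hpair c _ (filter_subset _ _) ?_ ?_
    · intro w hw
      obtain ⟨y, z, t, h1, h2, h3, -⟩ := (mem_filter.1 hw).2
      exact ⟨y, z, t, h1, h2, h3⟩
    · intro y z t z' t' hw hw' hz hz' hy
      obtain ⟨y₁, z₁, t₁, h1, h2, h3, h4, h5⟩ := (mem_filter.1 hw).2
      obtain ⟨y₂, z₂, t₂, h1', h2', h3', h4', h5'⟩ := (mem_filter.1 hw').2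
      obtain ⟨h6, -⟩ := List.append_inj h1 (by simp [hy, h3, hz, h2])
      obtain ⟨rfl, rfl⟩ := List.append_inj h6 (by simp [hy, h3])
      obtain ⟨h6', -⟩ := List.append_inj h1' (by simp [h3, h3', hz', h2'])
      obtain ⟨rfl, rfl⟩ := List.append_inj h6' (by simp [h3, h3'])
      exact eq_of_isPrefix_append h4 h5 h5' (hz.trans hz'.symm)
  have h₂ : ∀ c, (S₂ c).card * b ^ f ≤ 4 * b ^ n := by
    intro c
    refine hpair c _ (filter_subset _ _) ?_ ?_
    · intro w hw
      obtain ⟨y, z, t, h1, h2, h3, -⟩ := (mem_filter.1 hw).2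
      exact ⟨y, z, t, h1, h2, h3⟩
    · intro y z t z' t' hw hw' hz hz' hy
      obtain ⟨y₁, z₁, t₁, h1, h2, h3, h4⟩ := (mem_filter.1 hw).2
      obtain ⟨y₂, z₂, t₂, h1', h2', h3', h4'⟩ := (mem_filter.1 hw').2
      obtain ⟨h6, -⟩ := List.append_inj h1 (by simp [hy, h3, hz, h2])
      obtain ⟨rfl, rfl⟩ := List.append_inj h6 (by simp [hy, h3])
      obtain ⟨h6', -⟩ := List.append_inj h1' (by simp [h3, h3', hz', h2'])
      obtain ⟨rfl, rfl⟩ := List.append_inj h6' (by simp [h3, h3'])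
      exact h4.trans h4'.symm
  calc (overlapWords m n f).card * b ^ f
      ≤ (∑ c ∈ range (n + 1), ((S₁ c).card + (S₂ c).card)) * b ^ f := by
        refine Nat.mul_le_mul_right _ ((card_le_card hsub).trans (card_biUnion_le.trans ?_))
        exact sum_le_sum fun c _ => card_union_le _ _
    _ = ∑ c ∈ range (n + 1), ((S₁ c).card * b ^ f + (S₂ c).card * b ^ f) := by
        rw [sum_mul]
        exact sum_congr rfl fun c _ => add_mul _ _ _
    _ ≤ ∑ c ∈ range (n + 1), (4 * b ^ n + 4 * b ^ n) :=
        sum_le_sum fun c _ => add_le_add (h₁ c) (h₂ c)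
    _ = _ := by simp; ring

theorem hasOverlap_of_isPrefix_rotate {w v : GWord m} {c : ℕ} (hc : 0 < c)
    (hcv : c + v.length ≤ w.length) (h1 : v <+: w) (h2 : v <+: w.rotate c) :
    HasOverlap v.length w := by
  rw [List.rotate_eq_drop_append_take (by omega)] at h2
  obtain ⟨t, ht⟩ : v <+: w.drop c :=
    List.prefix_of_prefix_length_le h2 (List.prefix_append _ _) (by simp; omega)
  have hw : w = w.take c ++ v ++ t := by
    rw [List.append_assoc, ht, List.take_append_drop]
  refine ⟨w.take c, v, t, hw, rfl, Or.inl ⟨?_, ?_⟩⟩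
  · rw [ne_eq, ← List.length_eq_zero_iff, List.length_take]
    omega
  · refine List.prefix_of_prefix_length_le h1 ⟨t, hw.symm⟩ (by simp)

/-- In `w`, read cyclically, a copy of `v⁻¹` ends at position `c`. If it wrapped around the origin
or met the initial `v`, their common part would be a nonempty reduced word equal to its own inverse.
Hence it lies after that `v` and is determined by it. -/
theorem hasOverlap_of_isSuffix_rotate {w v : GWord m} {c : ℕ} (hw : FreeGroup.IsReduced w)
    (hc : 0 < c) (hcw : c ≤ w.length) (h1 : v <+: w)
    (h2 : FreeGroup.invRev v <:+ w.rotate c) : HasOverlap v.length w := by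
  rw [List.rotate_eq_drop_append_take hcw] at h2
  have hlc : (w.take c).length = c := by simp [hcw]
  have hli : (FreeGroup.invRev v).length = v.length := FreeGroup.invRev_length
  rcases Nat.lt_or_ge c v.length with hcv | hcv
  · exfalso
    obtain ⟨x', hx'⟩ : w.take c <+: v :=
      List.prefix_of_prefix_length_le (List.take_prefix _ _) h1 (by omega)
    have h3 : w.take c <:+ FreeGroup.invRev v :=
      List.suffix_of_suffix_length_le (List.suffix_append _ _) h2 (by omega)
    have h4 : FreeGroup.invRev (w.take c) <:+ FreeGroup.invRev v := by
      rw [← hx', FreeGroup.invRev_append]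
      exact List.suffix_append _ _
    have h5 : w.take c = FreeGroup.invRev (w.take c) :=
      (List.suffix_of_suffix_length_le h3 h4 (by simp)).eq_of_length (by simp)
    have h6 := eq_nil_of_eq_invRev (hw.infix (List.take_prefix _ _).isInfix) h5
    rw [h6] at hlc
    simp at hlc
    omega
  · obtain ⟨y, hy⟩ : FreeGroup.invRev v <:+ w.take c :=
      List.suffix_of_suffix_length_le h2 (List.suffix_append _ _) (by omega)
    have hly : y.length + v.length = c := by
      rw [← hlc, ← hy, List.length_append, hli]
    have hwy : w = y ++ FreeGroup.invRev v ++ w.drop c := by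
      rw [hy, List.take_append_drop]
    rcases Nat.lt_or_ge c (2 * v.length) with hc2 | hc2
    · exfalso
      obtain ⟨x, hx⟩ : y <+: v := List.prefix_of_prefix_length_le
        ⟨FreeGroup.invRev v ++ w.drop c, by rw [← List.append_assoc, ← hwy]⟩ h1 (by omega)
      have h3 : y ++ x <+: y ++ FreeGroup.invRev v := by
        rw [hx, hy]
        exact List.prefix_of_prefix_length_le h1 (List.take_prefix _ _) (by omega)
      rw [List.prefix_append_right_inj] at h3
      have h4 : FreeGroup.invRev x <+: FreeGroup.invRev v := by
        rw [← hx, FreeGroup.invRev_append]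
        exact List.prefix_append _ _
      have h5 : x = FreeGroup.invRev x :=
        (List.prefix_of_prefix_length_le h3 h4 (by simp)).eq_of_length (by simp)
      have hxr : FreeGroup.IsReduced x :=
        (hw.infix h1.isInfix).infix ⟨y, [], by rw [List.append_nil, hx]⟩
      have h6 := eq_nil_of_eq_invRev hxr h5
      rw [h6, List.append_nil] at hx
      rw [hx] at hly
      omega
    · refine ⟨y, FreeGroup.invRev v, w.drop c, hwy, hli, Or.inr ?_⟩
      congr 1
      have : v <+: y := List.prefix_of_prefix_length_le h1
        ⟨FreeGroup.invRev v ++ w.drop c, by rw [← List.append_assoc, ← hwy]⟩ (by omega)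
      exact List.prefix_iff_eq_take.1 this

theorem exists_hasOverlap_of_isPiece {r u : GWord m} {f : ℕ}
    (hr : FreeGroup.IsCyclicallyReduced r) (hu : IsPiece {r} u) (hf : f ≤ u.length)
    (hfr : 2 * f ≤ r.length) : ∃ w ∈ symmetrized {r}, HasOverlap f w := by
  obtain ⟨w₁, h₁, w₂, h₂, hne, hu₁, hu₂⟩ := hu
  have hl₁ := length_eq_of_mem_symmetrized h₁
  have hl₂ := length_eq_of_mem_symmetrized h₂
  have hv₁ := (List.take_prefix f u).trans hu₁
  have hv₂ := (List.take_prefix f u).trans hu₂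
  have hlv : (u.take f).length = f := by simp [hf]
  set v := u.take f
  rcases isRotated_or_of_mem_symmetrized h₁ h₂ with h | h
  · obtain ⟨c, hc, hcw⟩ := List.isRotated_iff_mod.1 h
    have hc0 : 0 < c := by
      rcases Nat.eq_zero_or_pos c with rfl | hc0
      · exact absurd (by simpa using hcw) hne
      · exact hc0
    have hcn : c < w₁.length := by
      rcases hc.lt_or_eq with hlt | rfl
      · exact hlt
      · exact absurd (by simpa using hcw) hne
    -- If the second copy wraps around, the two words exchange roles: the shift becomes `w₁.length -
    -- c ≤ f`, and `2 * f ≤ r.length` leaves room for it.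
    rcases Nat.le_total (c + f) w₁.length with hle | hle
    · refine ⟨w₁, h₁, ?_⟩
      rw [← hlv]
      exact hasOverlap_of_isPrefix_rotate hc0 (by omega) hv₁ (hcw ▸ hv₂)
    · refine ⟨w₂, h₂, ?_⟩
      rw [← hlv]
      refine hasOverlap_of_isPrefix_rotate (c := w₁.length - c) (by omega) (by omega) hv₂ ?_
      rw [← hcw, List.rotate_rotate, Nat.add_sub_cancel' hc, List.rotate_length]
      exact hv₁
  · obtain ⟨c, hc, hcw⟩ := List.isRotated_iff_mod.1 h
    have hsuf : FreeGroup.invRev v <:+ FreeGroup.invRev w₂ := by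
      obtain ⟨t, ht⟩ := hv₂
      rw [← ht, FreeGroup.invRev_append]
      exact List.suffix_append _ _
    have hne' : 0 < w₁.length := by
      by_contra h0
      refine hne ?_
      rw [List.length_eq_zero_iff.1 (by omega : w₁.length = 0),
        List.length_eq_zero_iff.1 (by omega : w₂.length = 0)]
    refine ⟨w₁, h₁, ?_⟩
    rw [← hlv]
    have hred := (hr.of_mem_symmetrized h₁).isReduced
    -- A zero rotation is replaced by a full one, since the suffix criterion needs a positive shift.
    rcases Nat.eq_zero_or_pos c with rfl | hc0
    · refine hasOverlap_of_isSuffix_rotate (c := w₁.length) hred hne' le_rfl hv₁ ?_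
      rw [List.rotate_zero] at hcw
      rw [List.rotate_length, hcw]
      exact hsuf
    · refine hasOverlap_of_isSuffix_rotate hred hc0 hc hv₁ ?_
      rw [hcw]
      exact hsuf

end SelfOverlap

/-! ### Relators that can violate `B(2p)` together with `k` others. -/

section BadRelators

open Finset

variable {m : ℕ}

/-- If every word of a list either is short or is a cyclic subword of a relator other than `r`, then
the words of the list that are cyclic subwords of suitably chosen relators cover much of the
concatenation. -/
theorem exists_subset_totalLengthIn {R : Set (GWord m)} {r : GWord m} {n N : ℕ}
    (L : List (GWord m)) (hL : ∀ u ∈ L, N * u.length ≤ n ∨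
      ∃ r' ∈ R, r' ≠ r ∧ u ∈ cyclicSubwords {r'}) :
    ∃ T : Finset (GWord m), (↑T : Set (GWord m)) ⊆ R ∧ r ∉ T ∧ T.card ≤ L.length ∧
      N * L.flatten.length ≤
        N * totalLengthIn (cyclicSubwords T) L + (L.length - T.card) * n := by
  induction L with
  | nil => exact ⟨∅, by simp, by simp, by simp, by simp⟩
  | cons u L ih =>
    obtain ⟨T, hTR, hrT, hcard, hle⟩ := ih fun u hu => hL u (List.mem_cons_of_mem _ hu)
    have hmono : ∀ {S S' : Finset (GWord m)}, S ⊆ S' → cyclicSubwords S ⊆ cyclicSubwords S' := by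
      intro S S' h v hv
      obtain ⟨x, hx, hx'⟩ := mem_cyclicSubwords.1 hv
      exact mem_cyclicSubwords.2 ⟨x, h hx, hx'⟩
    have hstep : (L.length + 1 - T.card) * n = (L.length - T.card) * n + n := by
      rw [Nat.succ_sub hcard, Nat.succ_mul]
    -- The term `(L.length - T.card) * n` is a budget for short words. A short word spends one unit,
    -- a word from a relator already in `T` wastes one, and a word from a new relator enlarges `T`
    -- instead.
    rcases hL u List.mem_cons_self with hu | ⟨r', hr', hne, hu⟩
    · refine ⟨T, hTR, hrT, by simp; omega, ?_⟩
      rw [List.flatten_cons, List.length_append, totalLengthIn_cons, List.length_cons, hstep,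
        mul_add, mul_add]
      omega
    · by_cases hmem : r' ∈ T
      · refine ⟨T, hTR, hrT, by simp; omega, ?_⟩
        have hu' : u ∈ cyclicSubwords T := hmono (by simpa using hmem) hu
        rw [List.flatten_cons, List.length_append, totalLengthIn_cons, List.length_cons, hstep,
          mul_add, mul_add, if_pos hu']
        omega
      · refine ⟨insert r' T, ?_, ?_, ?_, ?_⟩
        · intro x hx
          rw [mem_coe, mem_insert] at hx
          rcases hx with rfl | hx
          · exact hr'
          · exact hTR hx
        · simp [hne.symm, hrT]
        · rw [card_insert_of_notMem hmem]
          simp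
          omega
        · have hu' : u ∈ cyclicSubwords (insert r' T) := hmono (by simp) hu
          have h1 : totalLengthIn (cyclicSubwords T) L ≤
              totalLengthIn (cyclicSubwords (insert r' T)) L :=
            totalLengthIn_mono (hmono (subset_insert _ _)) L
          rw [List.flatten_cons, List.length_append, totalLengthIn_cons, List.length_cons,
            card_insert_of_notMem hmem, Nat.add_sub_add_right, mul_add, mul_add, if_pos hu']
          have h2 := Nat.mul_le_mul_left N h1
          omega

/-- The words of length at most `ℓ` that can violate `B(2p)` together with the relators in `T`. -/
noncomputable def badRelators (p ℓ : ℕ) (T : Finset (GWord m)) : Finset (GWord m) :=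
  (range (ℓ + 1)).biUnion fun n => symmetrization
    (coveredWords (cyclicSubwords T) p n ((T.card + 1) * n / (2 * p + 2)) ∪
      overlapWords m n ((T.card + 1) * n / (2 * p + 2)))

theorem mem_badRelators {p ℓ : ℕ} {T : Finset (GWord m)} {r w : GWord m} (hr : r.length ≤ ℓ)
    (hw : w ∈ symmetrized {r})
    (h : w ∈ coveredWords (cyclicSubwords T) p r.length ((T.card + 1) * r.length / (2 * p + 2)) ∨
      w ∈ overlapWords m r.length ((T.card + 1) * r.length / (2 * p + 2))) :
    r ∈ badRelators p ℓ T :=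
  mem_biUnion.2 ⟨r.length, by simp; omega,
    mem_symmetrization.2 ⟨w, mem_union.2 h, mem_symmetrized_singleton_comm.1 hw⟩⟩

/-- This is the deterministic half of the first moment argument: a violation comes either from a
long self-overlap of `r`, or from `r` being covered to the extent `(k + 1) / (2p + 2)` by subwords
of `k` other relators. -/
theorem exists_mem_badRelators_of_not_satisfiesB {p ℓ : ℕ} (hp : 1 ≤ p) {R : Set (GWord m)}
    (hR : R ⊆ relatorBall m ℓ) (h : ¬ SatisfiesB p R) :
    ∃ T : Finset (GWord m), (↑T : Set (GWord m)) ⊆ R ∧ T.card ≤ p ∧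
      ∃ r ∈ R, r ∉ T ∧ r ∈ badRelators p ℓ T := by
  rw [SatisfiesB] at h
  push Not at h
  obtain ⟨w, hw, s, hsw, ⟨L, hLp, hL, rfl⟩, hs⟩ := h
  obtain ⟨r, hrR, hwr⟩ := mem_symmetrized_iff.1 hw
  have hred := (hR hrR).1
  have hlen := (hR hrR).2
  have hwl := length_eq_of_mem_symmetrized hwr
  by_cases hself : ∃ u ∈ L, IsPiece {r} u ∧ r.length < (2 * p + 2) * u.length
  · obtain ⟨u, huL, hu, hul⟩ := hself
    have h1 : r.length / (2 * p + 2) ≤ u.length :=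
      Nat.div_le_of_le_mul hul.le
    have h2 : 2 * (r.length / (2 * p + 2)) ≤ r.length := by
      have := Nat.div_mul_le_self r.length (2 * p + 2)
      nlinarith [Nat.zero_le (r.length / (2 * p + 2))]
    obtain ⟨v, hv, hov⟩ := exists_hasOverlap_of_isPiece hred hu h1 h2
    -- With `T = ∅` the threshold `(T.card + 1) * n / (2 * p + 2)` is exactly the overlap length
    -- found.
    refine ⟨∅, by simp, by simp, r, hrR, by simp, mem_badRelators hlen hv (Or.inr ?_)⟩
    refine mem_overlapWords.2 ⟨⟨length_eq_of_mem_symmetrized hv,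
      (hred.of_mem_symmetrized hv).isReduced⟩, ?_⟩
    simpa using hov
  · push Not at hself
    have hL' : ∀ u ∈ L, (2 * p + 2) * u.length ≤ r.length ∨
        ∃ r' ∈ R, r' ≠ r ∧ u ∈ cyclicSubwords {r'} := by
      intro u hu
      by_cases hpiece : IsPiece {r} u
      · exact Or.inl (hself u hu hpiece)
      right
      -- The rotation `ρ` of `w` starts at the factor `u`. One of the two distinct words witnessing
      -- that `u` is a piece differs from `ρ`; it cannot come from `r`, or `u` would be a piece of
      -- `{r}`.
      obtain ⟨A, B, rfl⟩ := List.append_of_mem hu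
      obtain ⟨C, hC⟩ := hsw
      have hwρ : w = A.flatten ++ (u ++ B.flatten ++ C) := by
        rw [← hC]; simp
      set ρ := (u ++ B.flatten ++ C) ++ A.flatten
      have hρ : ρ ∈ symmetrized {r} :=
        symmetrized_singleton_of_isRotated (hwρ ▸ List.isRotated_append) hwr
      have huρ : u <+: ρ := ⟨B.flatten ++ C ++ A.flatten, by simp [ρ]⟩
      have key : ∀ v ∈ symmetrized R, u <+: v → ρ ≠ v →
          ∃ r' ∈ R, r' ≠ r ∧ u ∈ cyclicSubwords {r'} := by
        intro v hv huv hne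
        obtain ⟨r', hr', hv'⟩ := mem_symmetrized_iff.1 hv
        refine ⟨r', hr', ?_, mem_cyclicSubwords.2 ⟨r', by simp, v, hv', huv⟩⟩
        rintro rfl
        exact hpiece ⟨ρ, hρ, v, hv', hne, huρ, huv⟩
      obtain ⟨w₁, h₁, w₂, h₂, hne, hu₁, hu₂⟩ := hL u hu
      by_cases hρ₁ : ρ = w₁
      · exact key w₂ h₂ hu₂ (hρ₁ ▸ hne)
      · exact key w₁ h₁ hu₁ hρ₁
    obtain ⟨T, hTR, hrT, hcard, hle⟩ := exists_subset_totalLengthIn L hL'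
    refine ⟨T, hTR, hcard.trans hLp, r, hrR, hrT, mem_badRelators hlen hwr (Or.inl ?_)⟩
    refine mem_coveredWords.2 ⟨⟨hwl, (hred.of_mem_symmetrized hwr).isReduced⟩, L, hLp, hsw, ?_⟩
    refine Nat.div_le_of_le_mul ?_
    have h1 : (p + 1) * r.length ≤ (2 * p + 2) * L.flatten.length := by
      rw [← hwl]
      calc (p + 1) * w.length ≤ (p + 1) * (2 * L.flatten.length) := Nat.mul_le_mul_left _ hs
        _ = _ := by ring
    have h2 : (L.length - T.card) * r.length + (T.card + 1) * r.length ≤ (p + 1) * r.length := by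
      rw [← add_mul]
      exact Nat.mul_le_mul_right _ (by omega)
    omega

theorem card_badRelators_le (hm : 0 < m) {p ℓ : ℕ} {T : Finset (GWord m)}
    (hT : ∀ r ∈ T, r.length ≤ ℓ) (hTp : T.card ≤ p) :
    ((badRelators p ℓ T).card : ℝ) ≤
      ((ℓ + 1) * (2 * (ℓ + 1)) * (2 * (p * (2 * (ℓ + 1)) * (ℓ + 1) + 2 * (ℓ + 1)) ^ p
          + 8 * (ℓ + 1)) * (2 * m - 1) : ℝ) *
        ((2 * m - 1 : ℝ) ^ ((ℓ : ℝ) * (1 - (T.card + 1) / (2 * p + 2)))) := by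
  have hm' : (1 : ℝ) ≤ m := by exact_mod_cast hm
  have hb1 : (1 : ℝ) ≤ 2 * m - 1 := by linarith
  have hbc : ((2 * m - 1 : ℕ) : ℝ) = 2 * m - 1 := by
    rw [Nat.cast_sub (by omega)]; push_cast; ring
  set b : ℝ := 2 * m - 1
  set D : ℕ := 2 * (p * (2 * (ℓ + 1)) * (ℓ + 1) + 2 * (ℓ + 1)) ^ p + 8 * (ℓ + 1)
  set k := T.card
  have hkp : ((k : ℝ) + 1) / (2 * p + 2) ≤ 1 := by
    rw [div_le_one (by positivity)]
    have : (k : ℝ) ≤ p := by exact_mod_cast hTp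
    linarith
  have hn : ∀ n ∈ range (ℓ + 1), ((symmetrization
      (coveredWords (cyclicSubwords T) p n ((k + 1) * n / (2 * p + 2)) ∪
      overlapWords m n ((k + 1) * n / (2 * p + 2)))).card : ℝ) ≤
      (2 * (ℓ + 1)) * D * b * b ^ ((ℓ : ℝ) * (1 - (k + 1) / (2 * p + 2))) := by
    intro n hn
    have hnl : n ≤ ℓ := by simpa [Nat.lt_succ_iff] using hn
    set f := (k + 1) * n / (2 * p + 2)
    set X := coveredWords (cyclicSubwords T) p n f ∪ overlapWords m n f
    have hX : ∀ r ∈ X, r.length ≤ ℓ := by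
      intro r hr
      rcases mem_union.1 hr with hr | hr
      · exact (mem_coveredWords.1 hr).1.1.le.trans hnl
      · exact (mem_overlapWords.1 hr).1.1.le.trans hnl
    have h1 : X.card * (2 * m - 1) ^ f ≤ D * (2 * m - 1) ^ n := by
      calc X.card * (2 * m - 1) ^ f ≤ (coveredWords (cyclicSubwords T) p n f).card *
            (2 * m - 1) ^ f + (overlapWords m n f).card * (2 * m - 1) ^ f := by
            rw [← add_mul]
            exact Nat.mul_le_mul_right _ (card_union_le _ _)
        _ ≤ 2 * ((cyclicSubwords T).card + 2 * (ℓ + 1)) ^ p * (2 * m - 1) ^ n +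
            8 * (n + 1) * (2 * m - 1) ^ n :=
            add_le_add (card_coveredWords_mul_le hm _ p ℓ n f hnl) (card_overlapWords_mul_le m n f)
        _ = (2 * ((cyclicSubwords T).card + 2 * (ℓ + 1)) ^ p + 8 * (n + 1)) * (2 * m - 1) ^ n := by
            ring
        _ ≤ D * (2 * m - 1) ^ n := by
            refine Nat.mul_le_mul_right _ ?_
            have := (card_cyclicSubwords_le hT).trans
              (Nat.mul_le_mul_right (ℓ + 1) (Nat.mul_le_mul_right (2 * (ℓ + 1)) hTp))
            simp only [D]
            gcongr
    have h2 : (X.card : ℝ) * b ^ f ≤ D * b ^ n := by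
      rw [← hbc]; exact_mod_cast h1
    -- Rounding the threshold down loses less than one letter, which costs the extra factor `b`.
    have hf : ((k : ℝ) + 1) * n / (2 * p + 2) ≤ f + 1 := by
      have : (k + 1) * n < (f + 1) * (2 * p + 2) := Nat.lt_mul_of_div_lt (Nat.lt_succ_self _) (by omega)
      rw [div_le_iff₀ (by positivity)]
      exact_mod_cast this.le
    have h3 : (X.card : ℝ) ≤ D * b * b ^ ((ℓ : ℝ) * (1 - (k + 1) / (2 * p + 2))) := by
      have hbf : 0 < b ^ f := by positivity
      refine le_of_mul_le_mul_right ?_ hbf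
      refine h2.trans ?_
      have : b ^ n ≤ b * b ^ ((ℓ : ℝ) * (1 - (k + 1) / (2 * p + 2))) * b ^ f := by
        have hb0 : 0 < b := by linarith
        rw [← Real.rpow_natCast, ← Real.rpow_natCast]
        nth_rewrite 2 [← Real.rpow_one b]
        rw [← Real.rpow_add hb0, ← Real.rpow_add hb0]
        refine Real.rpow_le_rpow_of_exponent_le hb1 ?_
        have hnl' : (n : ℝ) ≤ ℓ := by exact_mod_cast hnl
        have h4 : (n : ℝ) * (1 - (k + 1) / (2 * p + 2)) ≤ ℓ * (1 - (k + 1) / (2 * p + 2)) :=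
          mul_le_mul_of_nonneg_right hnl' (by linarith)
        have h5 : (n : ℝ) * (1 - (k + 1) / (2 * p + 2)) = n - (k + 1) * n / (2 * p + 2) := by ring
        linarith
      calc (D : ℝ) * b ^ n ≤ D * (b * b ^ ((ℓ : ℝ) * (1 - (k + 1) / (2 * p + 2))) * b ^ f) := by
            gcongr
        _ = _ := by ring
    have h4 : ((symmetrization X).card : ℝ) ≤ X.card * (2 * (ℓ + 1)) := by
      exact_mod_cast card_symmetrization_le hX
    calc _ ≤ _ := h4
      _ ≤ (D * b * b ^ ((ℓ : ℝ) * (1 - (k + 1) / (2 * p + 2)))) * (2 * (ℓ + 1)) := by gcongr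
      _ = _ := by ring
  calc ((badRelators p ℓ T).card : ℝ) ≤ ∑ n ∈ range (ℓ + 1), ((symmetrization
      (coveredWords (cyclicSubwords T) p n ((k + 1) * n / (2 * p + 2)) ∪
      overlapWords m n ((k + 1) * n / (2 * p + 2)))).card : ℝ) := by
        exact_mod_cast card_biUnion_le
    _ ≤ ∑ n ∈ range (ℓ + 1), (2 * (ℓ + 1)) * D * b *
        b ^ ((ℓ : ℝ) * (1 - (k + 1) / (2 * p + 2))) := sum_le_sum hn
    _ = _ := by
        simp only [sum_const, card_range, nsmul_eq_mul, D]
        push_cast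
        ring

end BadRelators

/-! ### The size of `B_ℓ`. -/

section BallCard

open Finset

theorem card_relatorBall_le {m : ℕ} (hm : 2 ≤ m) (ℓ : ℕ) :
    Nat.card (relatorBall m ℓ) ≤ 4 * (2 * m - 1) ^ ℓ := by
  have hsub : relatorBall m ℓ ⊆ ((range (ℓ + 1)).biUnion (reducedWords m) : Finset (GWord m)) := by
    intro w hw
    rw [mem_coe, mem_biUnion]
    exact ⟨w.length, by simpa [Nat.lt_succ_iff] using hw.2, mem_reducedWords.2 ⟨rfl, hw.1.isReduced⟩⟩
  have h1 : Nat.card (relatorBall m ℓ) ≤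
      ((range (ℓ + 1)).biUnion (reducedWords m) : Finset (GWord m)).card := by
    rw [Nat.card_coe_set_eq]
    exact (Set.ncard_le_ncard hsub (finite_toSet _)).trans (Set.ncard_coe_finset _).le
  have hgeom : ∀ n, ∑ k ∈ range (n + 1), (2 * m - 1) ^ k ≤ 2 * (2 * m - 1) ^ n := by
    intro n
    induction n with
    | zero => simp
    | succ n ih =>
      rw [sum_range_succ]
      have : 2 * (2 * m - 1) ^ n ≤ (2 * m - 1) ^ (n + 1) := by
        rw [pow_succ, mul_comm]
        exact Nat.mul_le_mul_left _ (by omega)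
      omega
  calc _ ≤ _ := h1
    _ ≤ ∑ k ∈ range (ℓ + 1), (reducedWords m k).card := card_biUnion_le
    _ ≤ ∑ k ∈ range (ℓ + 1), 2 * (2 * m - 1) ^ k := sum_le_sum fun k _ => card_reducedWords_le m k
    _ ≤ _ := by
      rw [← mul_sum]
      have := hgeom ℓ
      omega

theorem pow_le_card_relatorBall {m : ℕ} (hm : 2 ≤ m) {ℓ : ℕ} (hℓ : 2 ≤ ℓ) :
    (2 * m - 1) ^ (ℓ - 2) ≤ Nat.card (relatorBall m ℓ) := by
  refine (pow_le_card_positiveWords hm (ℓ - 2)).trans ?_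
  rw [Nat.card_coe_set_eq, ← Set.ncard_coe_finset]
  refine Set.ncard_le_ncard ?_ (Set.toFinite _)
  intro w hw
  obtain ⟨h1, h2⟩ := mem_positiveWords.1 (mem_coe.1 hw)
  exact ⟨h2.isCyclicallyReduced, by omega⟩

theorem cast_two_mul_sub_one {m : ℕ} (hm : 2 ≤ m) : ((2 * m - 1 : ℕ) : ℝ) = 2 * m - 1 := by
  rw [Nat.cast_sub (by omega)]; push_cast; ring

theorem card_relatorBall_le_rpow {m : ℕ} (hm : 2 ≤ m) (ℓ : ℕ) :
    (Nat.card (relatorBall m ℓ) : ℝ) ≤ 4 * (2 * m - 1 : ℝ) ^ (ℓ : ℝ) := by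
  rw [Real.rpow_natCast, ← cast_two_mul_sub_one hm]
  exact_mod_cast card_relatorBall_le hm ℓ

theorem rpow_le_card_relatorBall {m : ℕ} (hm : 2 ≤ m) {ℓ : ℕ} (hℓ : 2 ≤ ℓ) :
    (2 * m - 1 : ℝ) ^ ((ℓ : ℝ) - 2) ≤ Nat.card (relatorBall m ℓ) := by
  have h : (ℓ : ℝ) - 2 = ((ℓ - 2 : ℕ) : ℝ) := by
    rw [Nat.cast_sub hℓ]; norm_num
  rw [h, Real.rpow_natCast, ← cast_two_mul_sub_one hm]
  exact_mod_cast pow_le_card_relatorBall hm hℓ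

theorem one_lt_two_mul_sub_one {m : ℕ} (hm : 2 ≤ m) : (1 : ℝ) < 2 * m - 1 := by
  have : (2 : ℝ) ≤ m := by exact_mod_cast hm
  linarith

theorem tendsto_card_relatorBall {m : ℕ} (hm : 2 ≤ m) :
    Tendsto (fun ℓ => (Nat.card (relatorBall m ℓ) : ℝ)) atTop atTop := by
  refine tendsto_atTop_mono' atTop (f₁ := fun ℓ : ℕ => (2 * m - 1 : ℝ) ^ ((ℓ : ℝ) - 2)) ?_ ?_
  · filter_upwards [eventually_ge_atTop 2] with ℓ hℓ
    exact rpow_le_card_relatorBall hm hℓ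
  · refine (tendsto_rpow_atTop_of_base_gt_one _ (one_lt_two_mul_sub_one hm)).comp ?_
    exact tendsto_atTop_add_const_right _ _ tendsto_natCast_atTop_atTop

end BallCard

/-! ### From densities to cardinalities. -/

section Density

variable {E : Type*} [Finite E]

theorem ncard_le_rpow_of_subsetDensity_lt {A : Set E} {c : ℝ} (hE : 2 ≤ Nat.card E)
    (h : subsetDensity A < (c : EReal)) : (A.ncard : ℝ) ≤ (Nat.card E : ℝ) ^ c := by
  have hE' : (1 : ℝ) < Nat.card E := by exact_mod_cast hE
  rcases A.eq_empty_or_nonempty with rfl | hA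
  · simp only [Set.ncard_empty, Nat.cast_zero]
    positivity
  · rw [subsetDensity, if_neg hA.ne_empty, EReal.coe_lt_coe_iff] at h
    have hpos : (0 : ℝ) < A.ncard := by exact_mod_cast (Set.ncard_pos A.toFinite).2 hA
    exact ((Real.logb_lt_iff_lt_rpow hE' hpos).1 h).le

theorem rpow_le_ncard_of_lt_subsetDensity {A : Set E} {c : ℝ} (hE : 2 ≤ Nat.card E)
    (h : (c : EReal) < subsetDensity A) : (Nat.card E : ℝ) ^ c ≤ A.ncard := by
  have hE' : (1 : ℝ) < Nat.card E := by exact_mod_cast hE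
  rcases A.eq_empty_or_nonempty with rfl | hA
  · simp [subsetDensity] at h
  · rw [subsetDensity, if_neg hA.ne_empty, EReal.coe_lt_coe_iff] at h
    have hpos : (0 : ℝ) < A.ncard := by exact_mod_cast (Set.ncard_pos A.toFinite).2 hA
    exact ((Real.lt_logb_iff_rpow_lt hE' hpos).1 h).le

end Density

/-! ### Below the critical density: the first moment bound tends to zero. -/

section FewRelators

open Finset

theorem card_perm_exists_bad_le_real {E : Type*} [Fintype E] [DecidableEq E] {k : ℕ} {Q a : ℝ}
    (hk : k < Nat.card E) (hQ : 0 ≤ Q) (Bad : Finset E → Finset E)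
    (hBad : ∀ T, T.card = k → ((Bad T).card : ℝ) ≤ Q) (A : Finset E) (hA : (A.card : ℝ) ≤ a) :
    ((univ.filter fun σ : Equiv.Perm E => ∃ T ⊆ A.image σ, T.card = k ∧
      ∃ r ∈ A.image σ, r ∉ T ∧ r ∈ Bad T).card : ℝ) ≤
      Q * a ^ (k + 1) / (Nat.card E - k) * Fintype.card (Equiv.Perm E) := by
  rw [Nat.card_eq_fintype_card] at hk ⊢
  have h1 : 0 < (Fintype.card E : ℝ) - k := by
    have : (k : ℝ) < Fintype.card E := by exact_mod_cast hk
    linarith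
  have h3 := card_perm_exists_bad_le k ⌊Q⌋₊ Bad (fun T hT => Nat.le_floor (hBad T hT)) A
  have h4 : ((Fintype.card E - k : ℕ) : ℝ) = Fintype.card E - k := Nat.cast_sub hk.le
  rw [div_mul_eq_mul_div, le_div_iff₀ h1, ← h4]
  have h5 := (Nat.cast_le (α := ℝ)).2 h3
  rw [Nat.cast_mul, Nat.cast_mul, Nat.cast_mul, Nat.cast_pow] at h5
  refine h5.trans ?_
  rw [mul_comm]
  have := Nat.floor_le hQ
  gcongr

variable {m : ℕ}

/-- A bound for the number of bad relators for a set of `k` relators. -/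
noncomputable def badBound (m p k ℓ : ℕ) : ℝ :=
  ((ℓ + 1) * (2 * (ℓ + 1)) * (2 * (p * (2 * (ℓ + 1)) * (ℓ + 1) + 2 * (ℓ + 1)) ^ p
      + 8 * (ℓ + 1)) * (2 * m - 1) : ℝ) *
    ((2 * m - 1 : ℝ) ^ ((ℓ : ℝ) * (1 - (k + 1) / (2 * p + 2))))

theorem badBound_nonneg (hm : 2 ≤ m) (p k ℓ : ℕ) : 0 ≤ badBound m p k ℓ := by
  have := one_lt_two_mul_sub_one hm
  have h0 : (0 : ℝ) ≤ 2 * m - 1 := by linarith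
  rw [badBound]
  positivity

/-- First moment estimate for a permutation invariant random subset: if `Q` forces the presence of a
set `T` of at most `p` elements and of a further element of `Bad T`, then `Q` is unlikely for
small subsets. -/
theorem measureReal_exists_bad_le {Ω' E : Type*} [MeasurableSpace Ω'] [Finite E]
    (P : Measure Ω') [IsProbabilityMeasure P] {R : Ω' → Set E} (hR : IsRandomSubset R)
    (hP : IsPermutationInvariant P R) {p : ℕ} (hp : p < Nat.card E) (Q : Set E → Prop)
    (Bad : Finset E → Finset E) (β : ℕ → ℝ) (hβ : ∀ k, 0 ≤ β k)
    (hBad : ∀ T, T.card ≤ p → ((Bad T).card : ℝ) ≤ β T.card)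
    (hQ : ∀ A, Q A → ∃ T : Finset E, (T : Set E) ⊆ A ∧ T.card ≤ p ∧ ∃ r ∈ A, r ∉ T ∧ r ∈ Bad T)
    {a : ℝ} (ha : 0 ≤ a) :
    P.real {ω | Q (R ω) ∧ ((R ω).ncard : ℝ) ≤ a} ≤
      ∑ k ∈ range (p + 1), β k * a ^ (k + 1) / (Nat.card E - k) := by
  classical
  have := Fintype.ofFinite E
  have hterm : ∀ k ∈ range (p + 1), 0 < (Nat.card E : ℝ) - k := by
    intro k hk
    have h1 : k < Nat.card E := by
      have := Finset.mem_range.1 hk; omega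
    have h2 : (k : ℝ) < Nat.card E := by exact_mod_cast h1
    linarith
  refine IsPermutationInvariant.measureReal_le P hR hP Q (fun n => (n : ℝ) ≤ a) ?_ ?_
  · exact sum_nonneg fun k hk =>
      div_nonneg (mul_nonneg (hβ k) (pow_nonneg ha _)) (hterm k hk).le
  intro A hA
  set B : Finset E := A.toFinset
  have hBc : (B.card : ℝ) ≤ a := by
    rwa [← Set.ncard_eq_toFinset_card' A]
  have hsub : (univ.filter fun σ : Equiv.Perm E => Q (σ '' A)) ⊆
      (range (p + 1)).biUnion fun k => univ.filter fun σ : Equiv.Perm E =>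
        ∃ T ⊆ B.image σ, T.card = k ∧ ∃ r ∈ B.image σ, r ∉ T ∧ r ∈ Bad T := by
    intro σ hσ
    obtain ⟨T, hT, hTc, r, hr, hrT, hrB⟩ := hQ _ (mem_filter.1 hσ).2
    have himage : ∀ x : E, x ∈ σ '' A → x ∈ B.image σ := by
      rintro _ ⟨y, hy, rfl⟩
      exact mem_image.2 ⟨y, by simpa [B] using hy, rfl⟩
    exact mem_biUnion.2 ⟨T.card, by simp; omega, mem_filter.2 ⟨mem_univ _,
      T, fun x hx => himage x (hT hx), rfl, r, himage r hr, hrT, hrB⟩⟩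
  rw [Nat.card_eq_fintype_card, Fintype.card_subtype, sum_mul]
  refine (Nat.cast_le.2 ((card_le_card hsub).trans card_biUnion_le)).trans ?_
  rw [Nat.cast_sum]
  refine sum_le_sum fun k hk => ?_
  have hk' := Finset.mem_range.1 hk
  rw [Nat.card_eq_fintype_card (α := Equiv.Perm E)]
  exact card_perm_exists_bad_le_real (by omega) (hβ k) Bad
    (fun T hT => by have := hBad T (by omega); rwa [hT] at this) B hBc

/-- Random sets of at most `n ^ c` relators rarely violate `B(2p)`. -/
theorem measureReal_not_satisfiesB_le (hm : 2 ≤ m) {p ℓ : ℕ} (hp : 1 ≤ p) {Ω' : Type*}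
    [MeasurableSpace Ω'] (P : Measure Ω') [IsProbabilityMeasure P]
    {R : Ω' → Set (relatorBall m ℓ)} (hR : IsRandomSubset R) (hP : IsPermutationInvariant P R)
    (hn : p < Nat.card (relatorBall m ℓ)) (c : ℝ) :
    P.real {ω | ¬ SatisfiesB p (Subtype.val '' R ω) ∧
        ((R ω).ncard : ℝ) ≤ (Nat.card (relatorBall m ℓ) : ℝ) ^ c} ≤
      ∑ k ∈ range (p + 1), badBound m p k ℓ * ((Nat.card (relatorBall m ℓ) : ℝ) ^ c) ^ (k + 1) /
        (Nat.card (relatorBall m ℓ) - k) := by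
  classical
  have := Fintype.ofFinite (relatorBall m ℓ)
  refine measureReal_exists_bad_le P hR hP hn (fun A => ¬ SatisfiesB p (Subtype.val '' A))
    (fun T => univ.filter fun r => r.val ∈ badRelators p ℓ (T.map (Function.Embedding.subtype _)))
    (fun k => badBound m p k ℓ) (fun k => badBound_nonneg hm p k ℓ) ?_ ?_ (by positivity)
  · intro T hT
    have h1 : (univ.filter fun r : relatorBall m ℓ =>
        r.val ∈ badRelators p ℓ (T.map (Function.Embedding.subtype _))).card ≤
        (badRelators p ℓ (T.map (Function.Embedding.subtype _))).card :=
      Finset.card_le_card_of_injOn Subtype.val (fun r hr => (mem_filter.1 hr).2)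
        Subtype.val_injective.injOn
    have h2 := card_badRelators_le (p := p) (ℓ := ℓ) (T := T.map (Function.Embedding.subtype _))
      (by omega : 0 < m) (by
        intro r hr
        obtain ⟨x, -, rfl⟩ := mem_map.1 hr
        exact x.2.2) (by rwa [card_map])
    rw [card_map] at h2
    exact (Nat.cast_le.2 h1).trans h2
  · intro A hA
    obtain ⟨T, hT, hTc, r, hr, hrT, hrB⟩ := exists_mem_badRelators_of_not_satisfiesB hp
      (fun w hw => by obtain ⟨x, -, rfl⟩ := hw; exact x.2) hA
    obtain ⟨r, hr, rfl⟩ := hr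
    have hTball : ∀ w ∈ T, w ∈ relatorBall m ℓ := by
      intro w hw
      obtain ⟨x, -, rfl⟩ := hT hw
      exact x.2
    have hmap : (T.subtype (· ∈ relatorBall m ℓ)).map (Function.Embedding.subtype _) = T :=
      Finset.subtype_map_of_mem hTball
    refine ⟨T.subtype (· ∈ relatorBall m ℓ), ?_, ?_, r, hr, ?_, ?_⟩
    · intro x hx
      obtain ⟨y, hy, hyx⟩ := hT (Finset.mem_subtype.1 hx)
      exact Subtype.ext hyx ▸ hy
    · rwa [← card_map (Function.Embedding.subtype _), hmap]
    · rwa [Finset.mem_subtype]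
    · refine mem_filter.2 ⟨mem_univ _, ?_⟩
      rwa [hmap]

/-- The exponents of `b` add up to `-ℓ * (k + 1) * (1 / (2p + 2) - c)`, and this exponential decay
beats the polynomial factor of degree `2p + 3`. -/
theorem tendsto_badBound_mul_div (hm : 2 ≤ m) {p k : ℕ} (hp : 1 ≤ p) {c : ℝ}
    (hc0 : 0 ≤ c) (hc : c < 1 / (2 * p + 2)) :
    Tendsto (fun ℓ : ℕ => badBound m p k ℓ * ((Nat.card (relatorBall m ℓ) : ℝ) ^ c) ^ (k + 1) /
        (Nat.card (relatorBall m ℓ) - k)) atTop (𝓝 0) := by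
  have hb1 := one_lt_two_mul_sub_one hm
  set b : ℝ := 2 * m - 1 with hb
  have hb0 : 0 < b := by linarith
  set δ : ℝ := (k + 1) * (1 / (2 * p + 2) - c)
  have hδ : 0 < δ := mul_pos (by positivity) (by linarith)
  set ρ : ℝ := b ^ (-δ)
  have hρ0 : 0 < ρ := Real.rpow_pos_of_pos hb0 _
  have hρ1 : ρ < 1 := Real.rpow_lt_one_of_one_lt_of_neg hb1 (by linarith)
  -- The division by `ρ` compensates for the power `ρ ^ (ℓ + 1)`, chosen so that the bound is a
  -- shift of `j ^ (2p + 3) * ρ ^ j`.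
  set K : ℝ := 2 * (2 * (2 * p + 2) ^ p + 8) * b * ((4 : ℝ) ^ c) ^ (k + 1) * (2 * b ^ (2 : ℝ)) / ρ
  have hlim : Tendsto (fun ℓ : ℕ => K * (((ℓ + 1 : ℕ) : ℝ) ^ (2 * p + 3) * ρ ^ (ℓ + 1)))
      atTop (𝓝 0) := by
    have h1 := (tendsto_pow_const_mul_const_pow_of_abs_lt_one (2 * p + 3) (r := ρ)
      (by rw [abs_of_pos hρ0]; exact hρ1)).comp (tendsto_add_atTop_nat 1)
    simpa using h1.const_mul K
  refine squeeze_zero' ?_ ?_ hlim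
  · filter_upwards [(tendsto_card_relatorBall hm).eventually_ge_atTop (k : ℝ)] with ℓ hℓ
    refine div_nonneg ?_ (by linarith)
    have := badBound_nonneg hm p k ℓ
    positivity
  · filter_upwards [(tendsto_card_relatorBall hm).eventually_ge_atTop (2 * k + 1 : ℝ),
      eventually_ge_atTop 2] with ℓ hℓ hℓ2
    set n : ℝ := (Nat.card (relatorBall m ℓ) : ℝ)
    have hn0 : 0 < n := by have : (0 : ℝ) ≤ k := by positivity
                           linarith
    have hnlo : b ^ ((ℓ : ℝ) - 2) ≤ n := rpow_le_card_relatorBall hm hℓ2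
    have hnhi : n ≤ 4 * b ^ (ℓ : ℝ) := card_relatorBall_le_rpow hm ℓ
    -- Since `n ≥ 2k + 1`, subtracting `k` at most halves `n`.
    have hden : b ^ ((ℓ : ℝ) - 2) / 2 ≤ n - k := by linarith
    have hpow : (n ^ c) ^ (k + 1) ≤ ((4 : ℝ) ^ c) ^ (k + 1) * b ^ ((ℓ : ℝ) * (c * (k + 1))) := by
      calc (n ^ c) ^ (k + 1) ≤ ((4 * b ^ (ℓ : ℝ)) ^ c) ^ (k + 1) := by gcongr
        _ = _ := by
          rw [Real.mul_rpow (by norm_num) (by positivity), mul_pow, ← Real.rpow_mul hb0.le,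
            ← Real.rpow_mul_natCast hb0.le]
          push_cast
          ring_nf
    have hpoly : ((ℓ + 1) * (2 * (ℓ + 1)) * (2 * (p * (2 * (ℓ + 1)) * (ℓ + 1) + 2 * (ℓ + 1)) ^ p
        + 8 * (ℓ + 1)) : ℝ) ≤ 2 * (2 * (2 * p + 2) ^ p + 8) * ((ℓ + 1 : ℕ) : ℝ) ^ (2 * p + 3) := by
      push_cast
      set x : ℝ := (ℓ : ℝ) + 1
      have hx : 1 ≤ x := by simp only [x]; linarith [(Nat.cast_nonneg ℓ : (0 : ℝ) ≤ ℓ)]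
      have h1 : (p * (2 * x) * x + 2 * x : ℝ) ≤ (2 * p + 2) * x ^ 2 := by nlinarith
      have h2 : (p * (2 * x) * x + 2 * x : ℝ) ^ p ≤ (2 * p + 2) ^ p * x ^ (2 * p + 1) := by
        calc (p * (2 * x) * x + 2 * x : ℝ) ^ p ≤ ((2 * p + 2) * x ^ 2) ^ p := by gcongr
          _ = (2 * p + 2) ^ p * x ^ (2 * p) := by rw [mul_pow, ← pow_mul]
          _ ≤ _ := by
            have : x ^ (2 * p) ≤ x ^ (2 * p + 1) := pow_le_pow_right₀ hx (by omega)
            gcongr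
      have h3 : x ≤ x ^ (2 * p + 1) := le_self_pow₀ hx (by omega)
      calc x * (2 * x) * (2 * (p * (2 * x) * x + 2 * x) ^ p + 8 * x)
          ≤ x * (2 * x) * (2 * ((2 * p + 2) ^ p * x ^ (2 * p + 1)) + 8 * x ^ (2 * p + 1)) := by
            gcongr
        _ = _ := by ring
    have hbad : badBound m p k ℓ ≤ 2 * (2 * (2 * p + 2) ^ p + 8) * ((ℓ + 1 : ℕ) : ℝ) ^ (2 * p + 3) *
        b * b ^ ((ℓ : ℝ) * (1 - (k + 1) / (2 * p + 2))) := by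
      rw [badBound, ← hb]
      gcongr
    have hexp : b ^ ((ℓ : ℝ) * (1 - (k + 1) / (2 * p + 2))) * b ^ ((ℓ : ℝ) * (c * (k + 1))) =
        (b ^ ((ℓ : ℝ) - 2) / 2) * ((2 * b ^ (2 : ℝ)) / ρ * ρ ^ (ℓ + 1)) := by
      rw [pow_succ]
      have h1 : (b ^ ((ℓ : ℝ) - 2) / 2) * ((2 * b ^ (2 : ℝ)) / ρ * (ρ ^ ℓ * ρ)) =
          b ^ ((ℓ : ℝ) - 2) * b ^ (2 : ℝ) * ρ ^ ℓ := by
        field_simp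
      rw [h1, ← Real.rpow_mul_natCast hb0.le, ← Real.rpow_add hb0, ← Real.rpow_add hb0,
        ← Real.rpow_add hb0]
      congr 1
      simp only [δ]
      ring
    have hden0 : 0 < b ^ ((ℓ : ℝ) - 2) / 2 := by positivity
    rw [div_le_iff₀ (lt_of_lt_of_le hden0 hden)]
    set Y : ℝ := 2 * (2 * (2 * p + 2) ^ p + 8) * ((ℓ + 1 : ℕ) : ℝ) ^ (2 * p + 3) * b
    calc badBound m p k ℓ * (n ^ c) ^ (k + 1)
        ≤ (Y * b ^ ((ℓ : ℝ) * (1 - (k + 1) / (2 * p + 2)))) *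
          (((4 : ℝ) ^ c) ^ (k + 1) * b ^ ((ℓ : ℝ) * (c * (k + 1)))) := by
          have : 0 ≤ Y := by positivity
          gcongr
      _ = Y * ((4 : ℝ) ^ c) ^ (k + 1) * (b ^ ((ℓ : ℝ) * (1 - (k + 1) / (2 * p + 2))) *
          b ^ ((ℓ : ℝ) * (c * (k + 1)))) := by ring
      _ = (K * (((ℓ + 1 : ℕ) : ℝ) ^ (2 * p + 3) * ρ ^ (ℓ + 1))) * (b ^ ((ℓ : ℝ) - 2) / 2) := by
          rw [hexp]
          simp only [Y, K]
          ring
      _ ≤ _ := by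
          refine mul_le_mul_of_nonneg_left hden ?_
          positivity

end FewRelators

/-! ### Monotonicity of `B(2p)` and a criterion for its failure. -/

section Violation

variable {m : ℕ}

theorem symmetrized_mono {R S : Set (GWord m)} (h : R ⊆ S) : symmetrized R ⊆ symmetrized S :=
  fun _ ⟨r, hr, hw⟩ => ⟨r, h hr, hw⟩

theorem IsPiece.mono {R S : Set (GWord m)} (h : R ⊆ S) {u : GWord m} (hu : IsPiece R u) :
    IsPiece S u := by
  obtain ⟨w₁, h₁, w₂, h₂, h'⟩ := hu
  exact ⟨w₁, symmetrized_mono h h₁, w₂, symmetrized_mono h h₂, h'⟩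

theorem SatisfiesWeakB.anti {p : ℕ} {R S : Set (GWord m)} (h : R ⊆ S) (hS : SatisfiesWeakB p S) :
    SatisfiesWeakB p R := by
  rintro r hr s hs ⟨L, hL, hu, rfl⟩
  exact hS r (symmetrized_mono h hr) _ hs ⟨L, hL, fun u hu' => (hu u hu').mono h, rfl⟩

theorem SatisfiesB.satisfiesWeakB {p : ℕ} {R : Set (GWord m)} (h : SatisfiesB p R) :
    SatisfiesWeakB p R :=
  fun r hr s hs hp => (h r hr s hs hp).le

theorem mem_symmetrized_self {R : Set (GWord m)} {r : GWord m} (hr : r ∈ R) : r ∈ symmetrized R :=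
  ⟨r, hr, Or.inl (List.IsRotated.refl r)⟩

/-- A relator with a long initial segment that is a product of at most `p` initial segments of
relators of another length violates `B(2p)`. -/
theorem not_satisfiesWeakB {p : ℕ} {R : Set (GWord m)} {w : GWord m} (hw : w ∈ R)
    {L : List (GWord m)} (hLp : L.length ≤ p) (hLw : L.flatten <+: w)
    (hlong : w.length < 2 * L.flatten.length)
    (hL : ∀ u ∈ L, ∃ r ∈ R, r.length ≠ w.length ∧ u <+: r) : ¬ SatisfiesWeakB p R := by
  intro h
  refine absurd (h w (mem_symmetrized_self hw) _ hLw ⟨L, hLp, ?_, rfl⟩) (by omega)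
  intro u hu
  obtain ⟨r, hr, hne, hur⟩ := hL u hu
  obtain ⟨A, B, rfl⟩ := List.append_of_mem hu
  obtain ⟨C, rfl⟩ := hLw
  have hrot : ((u ++ B.flatten ++ C) ++ A.flatten).IsRotated
      ((A ++ u :: B).flatten ++ C) := by
    have h1 : (A ++ u :: B).flatten ++ C = A.flatten ++ (u ++ B.flatten ++ C) := by simp
    rw [h1]
    exact List.isRotated_append
  -- The rotation of `w` beginning with `u` and the relator `r` are distinct because their lengths
  -- differ, so `u` is a piece.
  refine ⟨_, ⟨_, hw, Or.inl hrot⟩, r, mem_symmetrized_self hr, ?_, ?_, hur⟩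
  · intro h1
    exact hne (by rw [← h1, hrot.perm.length_eq])
  · exact ⟨B.flatten ++ C ++ A.flatten, by simp⟩

end Violation

/-! ### Relators built from prescribed positive-ended blocks. -/

section Concatenations

open Finset

variable {m : ℕ}

theorem card_image_append {α : Type*} [DecidableEq α] {A B : Finset (List α)} {L : ℕ}
    (hA : ∀ a ∈ A, a.length = L) :
    ((A ×ˢ B).image fun x => x.1 ++ x.2).card = A.card * B.card := by
  rw [card_image_of_injOn, card_product]
  rintro ⟨a, b⟩ h ⟨a', b'⟩ h' heq
  have h1 := hA a (mem_product.1 (mem_coe.1 h)).1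
  have h2 := hA a' (mem_product.1 (mem_coe.1 h')).1
  obtain ⟨h3, h4⟩ := List.append_inj heq (h1.trans h2.symm)
  exact Prod.ext h3 h4

/-- Products of `q` words of `D` and a final word of `T`. -/
def concatenations (D T : Finset (GWord m)) : ℕ → Finset (GWord m)
  | 0 => T
  | q + 1 => (D ×ˢ concatenations D T q).image fun x => x.1 ++ x.2

theorem card_concatenations {D T : Finset (GWord m)} {L : ℕ} (hD : ∀ u ∈ D, u.length = L) (q : ℕ) :
    (concatenations D T q).card = D.card ^ q * T.card := by
  induction q with
  | zero => simp [concatenations]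
  | succ q ih => rw [concatenations, card_image_append hD, ih]; ring

theorem exists_list_of_mem_concatenations {D T : Finset (GWord m)} {q : ℕ} {w : GWord m}
    (hw : w ∈ concatenations D T q) : ∃ L : List (GWord m), L.length = q ∧ (∀ u ∈ L, u ∈ D) ∧
      ∃ t ∈ T, w = L.flatten ++ t := by
  induction q generalizing w with
  | zero => exact ⟨[], rfl, by simp, w, hw, by simp⟩
  | succ q ih =>
    obtain ⟨⟨u, v⟩, huv, rfl⟩ := mem_image.1 hw
    obtain ⟨hu, hv⟩ := mem_product.1 huv
    obtain ⟨L, hL, hLD, t, ht, rfl⟩ := ih hv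
    refine ⟨u :: L, by simp [hL], ?_, t, ht, by simp⟩
    intro x hx
    rcases List.mem_cons.1 hx with rfl | hx
    · exact hu
    · exact hLD x hx

theorem mem_positiveWords_append {hm : 0 < m} {k l : ℕ} {u v : GWord m}
    (hu : u ∈ positiveWords hm k) (hv : v ∈ positiveWords hm l) :
    u ++ v ∈ positiveWords hm (k + l) := by
  rw [mem_positiveWords] at hu hv ⊢
  exact ⟨by rw [List.length_append, hu.1, hv.1], hu.2.append hv.2⟩

theorem concatenations_subset {hm : 0 < m} {D T : Finset (GWord m)} {L k : ℕ}
    (hD : D ⊆ positiveWords hm L) (hT : T ⊆ positiveWords hm k) (q : ℕ) :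
    concatenations D T q ⊆ positiveWords hm (q * L + k) := by
  induction q with
  | zero => simpa [concatenations] using hT
  | succ q ih =>
    intro w hw
    obtain ⟨⟨u, v⟩, huv, rfl⟩ := mem_image.1 hw
    obtain ⟨hu, hv⟩ := mem_product.1 huv
    have := mem_positiveWords_append (hD hu) (ih hv)
    rwa [show L + (q * L + k) = (q + 1) * L + k by ring] at this

theorem mem_relatorBall_of_mem_positiveWords {hm : 0 < m} {k ℓ : ℕ} (h : k ≤ ℓ) {w : GWord m}
    (hw : w ∈ positiveWords hm k) : w ∈ relatorBall m ℓ := by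
  rw [mem_positiveWords] at hw
  exact ⟨hw.2.isCyclicallyReduced, hw.1.trans_le h⟩

end Concatenations

/-! ### Sampling in two stages. -/

section TwoSamples

open Finset

/-- Two-stage sampling: the first sample determines a set of at least `K` labels, and then the
second sample hits a large set depending on these labels. -/
theorem card_two_samples_le {E W : Type*} [Fintype E] [DecidableEq E] [DecidableEq W] (M K : ℕ)
    (lab : E → Option W) (U : Finset W) (hU : K ≤ U.card) (s t : ℕ)
    (hs : ∀ D ⊆ U, D.card = K → (univ.filter fun e => ∀ u ∈ lab e, u ∈ U → u ∈ D).card ≤ s)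
    (G : Finset W → Finset E)
    (ht : ∀ D ⊆ U, K ≤ D.card → Fintype.card E - (G D).card ≤ t)
    (F : (Fin M → E) × (Fin M → E) → Prop) [DecidablePred F]
    (hF : ∀ g, F g → ∀ D ⊆ U, (∀ u ∈ D, ∃ i, lab (g.1 i) = some u) → ∀ i, g.2 i ∉ G D) :
    (univ.filter F).card ≤ U.card ^ K * s ^ M * Fintype.card E ^ M + Fintype.card E ^ M * t ^ M := by
  classical
  let D : (Fin M → E) → Finset W := fun g => U.filter fun u => ∃ i, lab (g i) = some u
  -- If the first sample shows fewer than `K` labels of `U`, some `D'` of size exactly `K` contains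
  -- all of them, and a union bound over `D'` applies. Otherwise every element of the second sample
  -- misses `G (D g)`.
  have hsub : univ.filter F ⊆
      ((powersetCard K U).biUnion fun D' => Fintype.piFinset fun _ : Fin M =>
        univ.filter fun e => ∀ u ∈ lab e, u ∈ U → u ∈ D') ×ˢ (univ : Finset (Fin M → E)) ∪
      ((univ.filter fun g => K ≤ (D g).card).sigma fun g : Fin M → E =>
        Fintype.piFinset fun _ : Fin M => univ \ G (D g)).image fun x => (x.1, x.2) := by
    rintro ⟨g, h⟩ hgh
    have hgF := (mem_filter.1 hgh).2
    rw [mem_union]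
    rcases Nat.lt_or_ge (D g).card K with hlt | hge
    · left
      obtain ⟨D', hDD', hD'U, hD'⟩ := exists_subsuperset_card_eq (filter_subset _ U) hlt.le hU
      refine mem_product.2 ⟨mem_biUnion.2 ⟨D', mem_powersetCard.2 ⟨hD'U, hD'⟩, ?_⟩, mem_univ _⟩
      refine Fintype.mem_piFinset.2 fun i => mem_filter.2 ⟨mem_univ _, fun u hu huU => ?_⟩
      exact hDD' (mem_filter.2 ⟨huU, i, hu⟩)
    · right
      refine mem_image.2 ⟨⟨g, h⟩, mem_sigma.2 ⟨mem_filter.2 ⟨mem_univ _, hge⟩, ?_⟩, rfl⟩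
      refine Fintype.mem_piFinset.2 fun i => mem_sdiff.2 ⟨mem_univ _, ?_⟩
      exact hF _ hgF (D g) (filter_subset _ _) (fun u hu => (mem_filter.1 hu).2) i
  refine (card_le_card hsub).trans ((card_union_le _ _).trans (Nat.add_le_add ?_ ?_))
  · rw [card_product, card_univ, Fintype.card_fun, Fintype.card_fin]
    refine Nat.mul_le_mul_right _ ?_
    refine (card_biUnion_le_card_mul _ _ (s ^ M) fun D' hD' => ?_).trans ?_
    · rw [Fintype.card_piFinset, prod_const, card_univ, Fintype.card_fin]
      exact Nat.pow_le_pow_left (hs D' (mem_powersetCard.1 hD').1 (mem_powersetCard.1 hD').2) _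
    · rw [card_powersetCard]
      exact Nat.mul_le_mul_right _ (Nat.choose_le_pow _ _)
  · refine card_image_le.trans ?_
    rw [card_sigma]
    refine (sum_le_card_nsmul _ _ (t ^ M) fun g hg => ?_).trans ?_
    · rw [Fintype.card_piFinset, prod_const, card_univ, Fintype.card_fin,
        card_sdiff_of_subset (subset_univ _), card_univ]
      exact Nat.pow_le_pow_left (ht _ (filter_subset _ _) (mem_filter.1 hg).2) _
    · rw [smul_eq_mul]
      refine Nat.mul_le_mul_right _ ((card_filter_le _ _).trans ?_)
      rw [card_univ, Fintype.card_fun, Fintype.card_fin]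

/-- A monotone property holds for most random subsets with at least `2 M` elements if it holds for
most unions of two random samples of `M` elements. -/
theorem measureReal_not_le_of_two_samples {Ω' E W : Type*} [MeasurableSpace Ω'] [Fintype E]
    [Nonempty E] [DecidableEq W]
    (P : Measure Ω') [IsProbabilityMeasure P] {R : Ω' → Set E} (hR : IsRandomSubset R)
    (hP : IsPermutationInvariant P R) (X : Set E → Prop) (hX : ∀ S T, S ⊆ T → X S → X T)
    (M K : ℕ) (lab : E → Option W) (U : Finset W) (hU : K ≤ U.card) {x y : ℝ} (hx : x ≤ 1)
    (hy : y ≤ 1)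
    (hs : ∀ D ⊆ U, D.card = K →
      x * Nat.card E ≤ Nat.card {e // ∃ u ∈ lab e, u ∈ U ∧ u ∉ D})
    (G : Finset W → Finset E)
    (ht : ∀ D ⊆ U, K ≤ D.card → y * Nat.card E ≤ (G D).card)
    (hF : ∀ (S : Set E), ∀ D ⊆ U, (∀ u ∈ D, ∃ e ∈ S, lab e = some u) → (∃ e ∈ S, e ∈ G D) → X S) :
    P.real {ω | ¬ X (R ω) ∧ 2 * M ≤ (R ω).ncard} ≤
      (U.card : ℝ) ^ K * (1 - x) ^ M + (1 - y) ^ M := by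
  classical
  set n := Fintype.card E
  have hn : 0 < (n : ℝ) := by exact_mod_cast Fintype.card_pos
  have hx0 : 0 ≤ 1 - x := by linarith
  have hy0 : 0 ≤ 1 - y := by linarith
  rw [Nat.card_eq_fintype_card] at hs ht
  refine IsPermutationInvariant.measureReal_le P hR hP (fun A => ¬ X A) (fun k => 2 * M ≤ k)
    (by positivity) ?_
  intro A hA
  set B : Finset E := A.toFinset
  have hBc : 2 * M ≤ B.card := by
    rwa [← Set.ncard_eq_toFinset_card' A]
  have h1 := card_perm_not_mul_le M (fun S : Finset E => X S)
    (fun S T hST => hX S T (by exact_mod_cast hST)) B hBc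
  have h2 := card_two_samples_le M K lab U hU ⌊(1 - x) * n⌋₊ ⌊(1 - y) * n⌋₊ (by
    intro D hD hDK
    refine Nat.le_floor ?_
    have h3 := hs D hD hDK
    rw [Nat.card_eq_fintype_card, Fintype.card_subtype] at h3
    have h4 := card_filter_add_card_filter_not (s := (univ : Finset E))
      (fun e => ∃ u ∈ lab e, u ∈ U ∧ u ∉ D)
    have h5 : (univ.filter fun e => ¬ ∃ u ∈ lab e, u ∈ U ∧ u ∉ D) =
        univ.filter fun e => ∀ u ∈ lab e, u ∈ U → u ∈ D := by
      ext e; simp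
    rw [h5, card_univ] at h4
    have h6 : ((univ.filter fun e => ∃ u ∈ lab e, u ∈ U ∧ u ∉ D).card : ℝ) +
        (univ.filter fun e => ∀ u ∈ lab e, u ∈ U → u ∈ D).card = n := by exact_mod_cast h4
    linarith) G (by
    intro D hD hDK
    refine Nat.le_floor ?_
    have h3 := ht D hD hDK
    rw [Nat.cast_sub (card_le_univ _)]
    linarith) (fun g => ¬ X ((univ.image g.1 ∪ univ.image g.2 : Finset E) : Set E)) (by
    intro g hg D hD hlab i hi
    refine hg (hF _ D hD ?_ ⟨g.2 i, by simp, hi⟩)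
    intro u hu
    obtain ⟨j, hj⟩ := hlab u hu
    exact ⟨g.1 j, by simp, hj⟩)
  have h3 : (univ.filter fun σ : Equiv.Perm E => ¬ X ((B.image σ : Finset E) : Set E)) =
      univ.filter fun σ : Equiv.Perm E => ¬ X (σ '' A) := by
    congr 1
    ext σ
    rw [coe_image, Set.coe_toFinset]
  rw [h3] at h1
  rw [Nat.card_eq_fintype_card, Fintype.card_subtype, Nat.card_eq_fintype_card]
  set Y := (univ.filter fun σ : Equiv.Perm E => ¬ X (σ '' A)).card
  set Z := (univ.filter fun g : (Fin M → E) × (Fin M → E) =>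
    ¬ X ((univ.image g.1 ∪ univ.image g.2 : Finset E) : Set E)).card
  have h1' : (Y : ℝ) * (n : ℝ) ^ (2 * M) ≤ Fintype.card (Equiv.Perm E) * Z := by exact_mod_cast h1
  have h2' : (Z : ℝ) ≤ (U.card : ℝ) ^ K * (⌊(1 - x) * n⌋₊ : ℝ) ^ M * (n : ℝ) ^ M +
      (n : ℝ) ^ M * (⌊(1 - y) * n⌋₊ : ℝ) ^ M := by exact_mod_cast h2
  have hf1 := Nat.floor_le (mul_nonneg hx0 hn.le)
  have hf2 := Nat.floor_le (mul_nonneg hy0 hn.le)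
  have h4 : (Z : ℝ) ≤ ((U.card : ℝ) ^ K * (1 - x) ^ M + (1 - y) ^ M) * (n : ℝ) ^ (2 * M) := by
    calc (Z : ℝ) ≤ _ := h2'
      _ ≤ (U.card : ℝ) ^ K * ((1 - x) * n) ^ M * (n : ℝ) ^ M + (n : ℝ) ^ M * ((1 - y) * n) ^ M := by
        gcongr
      _ = _ := by rw [mul_pow, mul_pow, two_mul, pow_add]; ring
  have hnM : 0 < (n : ℝ) ^ (2 * M) := by positivity
  refine le_of_mul_le_mul_right ?_ hnM
  calc (Y : ℝ) * (n : ℝ) ^ (2 * M) ≤ _ := h1'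
    _ ≤ Fintype.card (Equiv.Perm E) *
        (((U.card : ℝ) ^ K * (1 - x) ^ M + (1 - y) ^ M) * (n : ℝ) ^ (2 * M)) := by gcongr
    _ = _ := by ring

end TwoSamples

/-! ### Above the critical density: a violation is likely. -/

section ManyRelators

open Finset

/-- Random sets of at least `2 M` relators mostly violate `B(2p)`. -/
theorem measureReal_satisfiesWeakB_le {m : ℕ} (hm : 2 ≤ m) {p ℓ L k M K : ℕ} {Ω' : Type*}
    [MeasurableSpace Ω'] (P : Measure Ω') [IsProbabilityMeasure P]
    {R : Ω' → Set (relatorBall m ℓ)} (hR : IsRandomSubset R) (hP : IsPermutationInvariant P R)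
    (hL : 2 ≤ L) (hLℓ : L + 3 ≤ ℓ) (hk : 2 ≤ k) (hpk : p * L + k = ℓ) (hℓ : ℓ < 2 * (p * L))
    (hK : 2 * K ≤ (2 * m - 1) ^ (L - 2)) :
    P.real {ω | SatisfiesWeakB p (Subtype.val '' R ω) ∧ 2 * M ≤ (R ω).ncard} ≤
      (2 * (2 * m - 1 : ℝ) ^ L) ^ K * Real.exp (-(M * (1 / (8 * (2 * m - 1 : ℝ) ^ 5)))) +
        Real.exp (-(M * ((K : ℝ) ^ p * (2 * m - 1 : ℝ) ^ (k - 2) /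
          (4 * (2 * m - 1 : ℝ) ^ ℓ)))) := by
  classical
  have hm0 : 0 < m := by omega
  have hb1 := one_lt_two_mul_sub_one hm
  have hbc := cast_two_mul_sub_one hm
  set b : ℝ := 2 * m - 1
  have hb0 : 0 < b := by linarith
  have := Fintype.ofFinite (relatorBall m ℓ)
  have : Nonempty (relatorBall m ℓ) := ⟨⟨[], by simp [relatorBall]⟩⟩
  have hn : (Nat.card (relatorBall m ℓ) : ℝ) ≤ 4 * b ^ ℓ := by
    rw [← hbc]; exact_mod_cast card_relatorBall_le hm ℓ
  have hPW : ∀ i, 2 ≤ i → b ^ (i - 2) ≤ (positiveWords hm0 i).card := by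
    intro i hi
    have := pow_le_card_positiveWords hm (i - 2)
    rw [Nat.sub_add_cancel hi] at this
    rw [← hbc]; exact_mod_cast this
  have hKR : 2 * (K : ℝ) ≤ b ^ (L - 2) := by
    rw [← hbc]; exact_mod_cast hK
  set U := positiveWords hm0 L
  have hUL : ∀ u ∈ U, u.length = L := fun u hu => (mem_positiveWords.1 hu).1
  have hKU : K ≤ U.card := by
    have h1 := hPW L hL
    have h2 : (K : ℝ) ≤ U.card := by
      have : (0 : ℝ) ≤ K := by positivity
      linarith
    exact_mod_cast h2
  have hUcard : (U.card : ℝ) ≤ 2 * b ^ L := by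
    have h1 : U.card ≤ 2 * (2 * m - 1) ^ L :=
      (card_filter_le _ _).trans (card_reducedWords_le m L)
    rw [← hbc]; exact_mod_cast h1
  -- Labels are taken only from relators of length `ℓ - 1`, so that they are pieces when they recur
  -- in relators of length `ℓ`.
  set lab : relatorBall m ℓ → Option (GWord m) := fun e =>
    if e.val.length + 1 = ℓ then some (e.val.take L) else none
  set G : Finset (GWord m) → Finset (relatorBall m ℓ) := fun D =>
    univ.filter fun e => e.val ∈ concatenations D (positiveWords hm0 k) p
  have hx0 : 0 < 8 * b ^ 5 := by positivity
  have hx1 : 1 / (8 * b ^ 5) ≤ 1 := by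
    rw [div_le_one hx0]
    have := one_le_pow₀ hb1.le (n := 5)
    linarith
  have hKL : (K : ℝ) ≤ b ^ L := by
    have h1 : b ^ (L - 2) ≤ b ^ L := pow_le_pow_right₀ hb1.le (by omega)
    have : (0 : ℝ) ≤ K := by positivity
    linarith
  have hy1 : (K : ℝ) ^ p * b ^ (k - 2) / (4 * b ^ ℓ) ≤ 1 := by
    rw [div_le_one (by positivity)]
    calc (K : ℝ) ^ p * b ^ (k - 2) ≤ (b ^ L) ^ p * b ^ k := by
          have h1 : b ^ (k - 2) ≤ b ^ k := pow_le_pow_right₀ hb1.le (by omega)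
          gcongr
      _ = b ^ ℓ := by rw [← pow_mul, ← pow_add, mul_comm L, hpk]
      _ ≤ _ := by have : 0 < b ^ ℓ := by positivity
                  linarith
  have key := measureReal_not_le_of_two_samples P hR hP
    (fun S => ¬ SatisfiesWeakB p (Subtype.val '' S))
    (fun S T hST h h' => h (h'.anti (Set.image_mono hST))) M K lab U hKU hx1 hy1 ?_ G ?_ ?_
  · have h0 : 0 ≤ 1 - 1 / (8 * b ^ 5) := by linarith
    simp only [not_not] at key
    have hexp : ∀ z : ℝ, z ≤ 1 → (1 - z) ^ M ≤ Real.exp (-(M * z)) := by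
      intro z hz
      calc (1 - z) ^ M ≤ Real.exp (-z) ^ M :=
            pow_le_pow_left₀ (by linarith) (Real.one_sub_le_exp_neg z) M
        _ = _ := by rw [← Real.exp_nat_mul]; ring_nf
    refine key.trans (add_le_add ?_ (hexp _ hy1))
    exact mul_le_mul (pow_le_pow_left₀ (by positivity) hUcard K) (hexp _ hx1)
      (pow_nonneg h0 _) (by positivity)
  · intro D hD hDK
    set T := positiveWords hm0 (ℓ - 1 - L)
    set C := ((U \ D) ×ˢ T).image fun x => x.1 ++ x.2
    have hC : C.card = (U.card - K) * T.card := by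
      rw [card_image_append (L := L) fun a ha => hUL a (mem_sdiff.1 ha).1,
        card_sdiff_of_subset hD, hDK]
    have hCmem : ∀ w ∈ C, ∃ h : w ∈ relatorBall m ℓ,
        ∃ u ∈ lab ⟨w, h⟩, u ∈ U ∧ u ∉ D := by
      intro w hw
      obtain ⟨⟨u, v⟩, huv, rfl⟩ := mem_image.1 hw
      obtain ⟨hu, hv⟩ := mem_product.1 huv
      obtain ⟨huU, huD⟩ := mem_sdiff.1 hu
      have huvP := mem_positiveWords_append huU hv
      refine ⟨mem_relatorBall_of_mem_positiveWords (by omega) huvP, u, ?_, huU, huD⟩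
      have h1 : (u ++ v).length + 1 = ℓ := by
        rw [(mem_positiveWords.1 huvP).1]; omega
      simp only [lab, h1, if_true, Option.mem_some_iff]
      exact List.take_left' (hUL u huU)
    have hCle : C.card ≤ Nat.card {e // ∃ u ∈ lab e, u ∈ U ∧ u ∉ D} := by
      rw [← Nat.card_eq_finsetCard]
      refine Nat.card_le_card_of_injective
        (fun w : C => (⟨⟨w.1, (hCmem w.1 w.2).1⟩, (hCmem w.1 w.2).2⟩ :
          {e // ∃ u ∈ lab e, u ∈ U ∧ u ∉ D})) ?_
      intro w w' h
      exact Subtype.ext (congrArg (fun z => z.1.1) h)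
    have h1 : b ^ (L - 2) / 2 ≤ ((U.card - K : ℕ) : ℝ) := by
      rw [Nat.cast_sub hKU]
      have := hPW L hL
      linarith
    have h2 : b ^ (ℓ - 1 - L - 2) ≤ (T.card : ℝ) := hPW _ (by omega)
    -- Five letters are lost: two in each of the two counts of positive-ended words, and one from
    -- using length `ℓ - 1`.
    have h3 : b ^ ℓ = b ^ (L - 2) * b ^ (ℓ - 1 - L - 2) * b ^ 5 := by
      rw [← pow_add, ← pow_add]; congr 1; omega
    calc 1 / (8 * b ^ 5) * Nat.card (relatorBall m ℓ) ≤ 1 / (8 * b ^ 5) * (4 * b ^ ℓ) := by gcongr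
      _ = b ^ (L - 2) / 2 * b ^ (ℓ - 1 - L - 2) := by
          rw [h3]; field_simp; norm_num
      _ ≤ ((U.card - K : ℕ) : ℝ) * T.card := by gcongr
      _ = (C.card : ℝ) := by rw [hC]; push_cast; ring
      _ ≤ _ := by exact_mod_cast hCle
  · intro D hD hDK
    have hsub := concatenations_subset hD (subset_refl (positiveWords hm0 k)) p
    have h1 : (concatenations D (positiveWords hm0 k) p).card ≤ (G D).card := by
      have h2 : concatenations D (positiveWords hm0 k) p ⊆ (G D).image Subtype.val := by
        intro w hw
        exact mem_image.2 ⟨⟨w, mem_relatorBall_of_mem_positiveWords hpk.le (hsub hw)⟩,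
          mem_filter.2 ⟨mem_univ _, hw⟩, rfl⟩
      exact (card_le_card h2).trans card_image_le
    rw [card_concatenations fun u hu => hUL u (hD hu)] at h1
    have h2 := hPW k hk
    calc (K : ℝ) ^ p * b ^ (k - 2) / (4 * b ^ ℓ) * Nat.card (relatorBall m ℓ)
        ≤ (K : ℝ) ^ p * b ^ (k - 2) / (4 * b ^ ℓ) * (4 * b ^ ℓ) := by gcongr
      _ = (K : ℝ) ^ p * b ^ (k - 2) := by field_simp
      _ ≤ (D.card : ℝ) ^ p * (positiveWords hm0 k).card := by gcongr
      _ ≤ _ := by exact_mod_cast h1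
  · rintro S D hD hlab ⟨e, heS, heG⟩
    obtain ⟨Ls, hLs, hLD, t, ht, he⟩ := exists_list_of_mem_concatenations (mem_filter.1 heG).2
    have hflat : Ls.flatten.length = p * L := by
      rw [List.length_flatten, List.eq_replicate_of_mem (l := Ls.map List.length) (a := L) ?_]
      · simp [hLs]
      · intro x hx
        obtain ⟨u, hu, rfl⟩ := List.mem_map.1 hx
        exact hUL u (hD (hLD u hu))
    have helen : e.val.length = ℓ := by
      rw [he, List.length_append, hflat, (mem_positiveWords.1 ht).1, hpk]
    refine not_satisfiesWeakB (w := e.val) ⟨e, heS, rfl⟩ hLs.le ⟨t, he.symm⟩ (by omega) ?_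
    intro u hu
    obtain ⟨e', he'S, he'⟩ := hlab u (hLD u hu)
    simp only [lab] at he'
    split_ifs at he' with hlen
    refine ⟨e'.val, ⟨e', he'S, rfl⟩, by omega, ?_⟩
    rw [← Option.some.inj he']
    exact List.take_prefix _ _

end ManyRelators

/-! ### Asymptotics of the two error terms. -/

section Growth

theorem tendsto_rpow_mul_natCast_atTop {b s : ℝ} (hb : 1 < b) (hs : 0 < s) :
    Tendsto (fun ℓ : ℕ => b ^ (s * (ℓ : ℝ))) atTop atTop :=
  (tendsto_rpow_atTop_of_base_gt_one b hb).comp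
    (tendsto_natCast_atTop_atTop.const_mul_atTop hs)

theorem eventually_mul_rpow_le_rpow {b s t : ℝ} (hb : 1 < b) (hst : s < t) (C : ℝ) :
    ∀ᶠ ℓ : ℕ in atTop, C * b ^ (s * (ℓ : ℝ)) ≤ b ^ (t * (ℓ : ℝ)) := by
  have hb0 : 0 < b := by linarith
  filter_upwards [(tendsto_rpow_mul_natCast_atTop hb (sub_pos.2 hst)).eventually_ge_atTop C]
    with ℓ hℓ
  calc C * b ^ (s * (ℓ : ℝ)) ≤ b ^ ((t - s) * (ℓ : ℝ)) * b ^ (s * (ℓ : ℝ)) := by gcongr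
    _ = _ := by rw [← Real.rpow_add hb0]; ring_nf

theorem tendsto_rpow_sub_linear_mul_rpow {b s t : ℝ} (hb : 1 < b) (hst : s < t) (ht : 0 < t)
    {x : ℝ} (hx : 0 < x) (C : ℝ) :
    Tendsto (fun ℓ : ℕ => x * b ^ (t * (ℓ : ℝ)) - C * (ℓ + 2) * b ^ (s * (ℓ : ℝ))) atTop atTop := by
  have hb0 : 0 < b := by linarith
  set r : ℝ := b ^ (-(t - s))
  have hr0 : 0 < r := Real.rpow_pos_of_pos hb0 _
  have hr1 : r < 1 := Real.rpow_lt_one_of_one_lt_of_neg hb (by linarith)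
  have h1 : Tendsto (fun ℓ : ℕ => x - C * (((ℓ : ℝ) ^ 1 * r ^ ℓ) + 2 * r ^ ℓ)) atTop (𝓝 x) := by
    have h2 := tendsto_pow_const_mul_const_pow_of_abs_lt_one 1 (r := r)
      (by rw [abs_of_pos hr0]; exact hr1)
    have h3 := tendsto_pow_atTop_nhds_zero_of_lt_one hr0.le hr1
    simpa using ((h2.add (h3.const_mul 2)).const_mul C).const_sub x
  refine ((tendsto_rpow_mul_natCast_atTop hb ht).atTop_mul_pos hx h1).congr fun ℓ => ?_
  have h2 : b ^ (s * (ℓ : ℝ)) = b ^ (t * (ℓ : ℝ)) * r ^ ℓ := by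
    rw [← Real.rpow_mul_natCast hb0.le, ← Real.rpow_add hb0]
    ring_nf
  rw [h2]
  ring

theorem ceil_le_two_mul {x : ℝ} (hx : 1 ≤ x) : (⌈x⌉₊ : ℝ) ≤ 2 * x := by
  have := (Nat.ceil_lt_add_one (by linarith : 0 ≤ x)).le
  linarith

/-- The union bound over label sets costs `exp (O(ℓ * b ^ (sℓ)))`, which is negligible against `exp
(-x * b ^ (tℓ))` for `s < t`. -/
theorem tendsto_pow_ceil_mul_exp_neg_ceil {b s t x : ℝ} (hb : 2 ≤ b) (hs : 0 ≤ s) (hst : s < t)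
    (hx : 0 < x) (L : ℕ → ℕ) (hL : ∀ ℓ, L ℓ ≤ ℓ + 1) :
    Tendsto (fun ℓ : ℕ => (2 * b ^ L ℓ) ^ ⌈b ^ (s * (ℓ : ℝ))⌉₊ *
      Real.exp (-(⌈b ^ (t * (ℓ : ℝ))⌉₊ * x))) atTop (𝓝 0) := by
  have hb1 : 1 < b := by linarith
  have hb0 : 0 < b := by linarith
  have hlim := Real.tendsto_exp_neg_atTop_nhds_zero.comp
    (tendsto_rpow_sub_linear_mul_rpow hb1 hst (by linarith) hx (2 * Real.log b))
  refine squeeze_zero (fun ℓ => by positivity) (fun ℓ => ?_) hlim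
  have h1 : 2 * b ^ L ℓ ≤ Real.exp (Real.log b * (ℓ + 2)) := by
    calc 2 * b ^ L ℓ ≤ b * b ^ (ℓ + 1) := by
          have := pow_le_pow_right₀ hb1.le (hL ℓ)
          gcongr
      _ = b ^ (ℓ + 2) := by ring
      _ = _ := by
        rw [← Real.rpow_def_of_pos hb0, ← Real.rpow_natCast]
        push_cast
        rfl
  have h2 : (⌈b ^ (s * (ℓ : ℝ))⌉₊ : ℝ) ≤ 2 * b ^ (s * (ℓ : ℝ)) :=
    ceil_le_two_mul (Real.one_le_rpow hb1.le (by positivity))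
  have h3 := Nat.le_ceil (b ^ (t * (ℓ : ℝ)))
  have hlog : 0 ≤ Real.log b := Real.log_nonneg hb1.le
  calc _ ≤ Real.exp (Real.log b * (ℓ + 2)) ^ ⌈b ^ (s * (ℓ : ℝ))⌉₊ *
        Real.exp (-(⌈b ^ (t * (ℓ : ℝ))⌉₊ * x)) := by gcongr
    _ = Real.exp (⌈b ^ (s * (ℓ : ℝ))⌉₊ * (Real.log b * (ℓ + 2)) +
        -(⌈b ^ (t * (ℓ : ℝ))⌉₊ * x)) := by rw [Real.exp_add, Real.exp_nat_mul]
    _ ≤ _ := by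
      refine Real.exp_le_exp.2 ?_
      have h4 : ⌈b ^ (s * (ℓ : ℝ))⌉₊ * (Real.log b * (ℓ + 2)) ≤
          2 * b ^ (s * (ℓ : ℝ)) * (Real.log b * (ℓ + 2)) := by gcongr
      have h5 : b ^ (t * (ℓ : ℝ)) * x ≤ ⌈b ^ (t * (ℓ : ℝ))⌉₊ * x := by gcongr
      linarith

/-- As `k ℓ` is at least `ℓ / 2` up to a constant, the expected number of hits in the second sample
grows at least like `b ^ ((t + p * s - 1/2) * ℓ)`. -/
theorem tendsto_exp_neg_ceil_mul {b s t : ℝ} (hb : 1 < b) {p : ℕ} (hst : 1 / 2 < t + p * s)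
    (k : ℕ → ℕ) (hk : ∀ᶠ ℓ : ℕ in atTop, (ℓ : ℝ) / 2 - p - 2 ≤ ((k ℓ - 2 : ℕ) : ℝ)) :
    Tendsto (fun ℓ : ℕ => Real.exp (-(⌈b ^ (t * (ℓ : ℝ))⌉₊ *
      ((⌈b ^ (s * (ℓ : ℝ))⌉₊ : ℝ) ^ p * b ^ (k ℓ - 2) / (4 * b ^ ℓ))))) atTop (𝓝 0) := by
  have hb0 : 0 < b := by linarith
  refine Real.tendsto_exp_neg_atTop_nhds_zero.comp ?_
  have h1 : Tendsto (fun ℓ : ℕ => b ^ (-(p : ℝ) - 2) / 4 * b ^ ((t + p * s - 1 / 2) * (ℓ : ℝ)))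
      atTop atTop :=
    (tendsto_rpow_mul_natCast_atTop hb (by linarith)).const_mul_atTop (by positivity)
  refine tendsto_atTop_mono' atTop ?_ h1
  filter_upwards [hk] with ℓ hℓ
  have h2 := Nat.le_ceil (b ^ (t * (ℓ : ℝ)))
  have h3 := Nat.le_ceil (b ^ (s * (ℓ : ℝ)))
  have h4 : b ^ ((ℓ : ℝ) / 2 - p - 2) ≤ b ^ (k ℓ - 2) := by
    rw [← Real.rpow_natCast b (k ℓ - 2)]
    exact Real.rpow_le_rpow_of_exponent_le hb.le hℓ
  calc b ^ (-(p : ℝ) - 2) / 4 * b ^ ((t + p * s - 1 / 2) * (ℓ : ℝ))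
      = b ^ (t * (ℓ : ℝ)) * ((b ^ (s * (ℓ : ℝ))) ^ p * b ^ ((ℓ : ℝ) / 2 - p - 2) / (4 * b ^ ℓ)) := by
        have h5 : b ^ (-(p : ℝ) - 2) * b ^ ((t + p * s - 1 / 2) * (ℓ : ℝ)) * b ^ ℓ =
            b ^ (t * (ℓ : ℝ)) * (b ^ (s * (ℓ : ℝ))) ^ p * b ^ ((ℓ : ℝ) / 2 - p - 2) := by
          rw [← Real.rpow_natCast b ℓ, ← Real.rpow_mul_natCast hb0.le, ← Real.rpow_add hb0,
            ← Real.rpow_add hb0, ← Real.rpow_add hb0, ← Real.rpow_add hb0]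
          ring_nf
        rw [mul_div_assoc', eq_div_iff (by positivity)]
        linear_combination h5
    _ ≤ _ := by gcongr

end Growth

/-! ### Passage to asymptotically almost sure statements. -/

section AsymptoticallyAlmostSurely

universe u

/-- The event `D` stands for a density close to its limit. Only subadditivity is used, so
measurability of `Q` and `D` plays no role. -/
theorem aas_of_measureReal_le {Ω : ℕ → Type u} [∀ ℓ, MeasurableSpace (Ω ℓ)]
    {P : ∀ ℓ, Measure (Ω ℓ)} [∀ ℓ, IsProbabilityMeasure (P ℓ)] {Q D : ∀ ℓ, Ω ℓ → Prop}
    (hD : Tendsto (fun ℓ => P ℓ {ω | ¬ D ℓ ω}) atTop (𝓝 0)) {ε : ℕ → ℝ}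
    (hε : Tendsto ε atTop (𝓝 0))
    (h : ∀ᶠ ℓ in atTop, (P ℓ).real {ω | ¬ Q ℓ ω ∧ D ℓ ω} ≤ ε ℓ) : AAS P Q := by
  have h0 : Tendsto (fun ℓ => P ℓ {ω | ¬ D ℓ ω} + ENNReal.ofReal (ε ℓ)) atTop (𝓝 0) := by
    simpa using hD.add (ENNReal.tendsto_ofReal hε)
  have h1 : Tendsto (fun ℓ => 1 - (P ℓ {ω | ¬ D ℓ ω} + ENNReal.ofReal (ε ℓ))) atTop (𝓝 1) := by
    simpa using ENNReal.Tendsto.sub tendsto_const_nhds h0 (Or.inl ENNReal.one_ne_top)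
  refine tendsto_of_tendsto_of_tendsto_of_le_of_le' h1 tendsto_const_nhds ?_
    (Eventually.of_forall fun ℓ => prob_le_one)
  filter_upwards [h] with ℓ hℓ
  rw [tsub_le_iff_right]
  have h2 : (P ℓ) {ω | ¬ Q ℓ ω ∧ D ℓ ω} ≤ ENNReal.ofReal (ε ℓ) := by
    rw [← ofReal_measureReal]
    exact ENNReal.ofReal_le_ofReal hℓ
  have h3 : (Set.univ : Set (Ω ℓ)) ⊆
      {ω | Q ℓ ω} ∪ ({ω | ¬ D ℓ ω} ∪ {ω | ¬ Q ℓ ω ∧ D ℓ ω}) := by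
    intro ω _
    by_cases hQ : Q ℓ ω
    · exact Or.inl hQ
    · by_cases hDω : D ℓ ω
      · exact Or.inr (Or.inr ⟨hQ, hDω⟩)
      · exact Or.inr (Or.inl hDω)
  calc (1 : ENNReal) = P ℓ Set.univ := measure_univ.symm
    _ ≤ _ := measure_mono h3
    _ ≤ P ℓ {ω | Q ℓ ω} + P ℓ ({ω | ¬ D ℓ ω} ∪ {ω | ¬ Q ℓ ω ∧ D ℓ ω}) := measure_union_le _ _
    _ ≤ P ℓ {ω | Q ℓ ω} + (P ℓ {ω | ¬ D ℓ ω} + P ℓ {ω | ¬ Q ℓ ω ∧ D ℓ ω}) := by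
      gcongr
      exact measure_union_le _ _
    _ ≤ _ := by gcongr

theorem AAS.mono {Ω : ℕ → Type u} [∀ ℓ, MeasurableSpace (Ω ℓ)]
    {P : ∀ ℓ, Measure (Ω ℓ)} [∀ ℓ, IsProbabilityMeasure (P ℓ)] {Q Q' : ∀ ℓ, Ω ℓ → Prop}
    (hQ : AAS P Q) (h : ∀ ℓ ω, Q ℓ ω → Q' ℓ ω) : AAS P Q' :=
  tendsto_of_tendsto_of_tendsto_of_le_of_le hQ tendsto_const_nhds
    (fun ℓ => measure_mono (h ℓ)) (fun _ => prob_le_one)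

variable {Ω : ℕ → Type u} [∀ ℓ, MeasurableSpace (Ω ℓ)] {P : ∀ ℓ, Measure (Ω ℓ)}
  [∀ ℓ, IsProbabilityMeasure (P ℓ)] {m : ℕ} {p : ℕ} {d : EReal}
  {R : ∀ ℓ, Ω ℓ → Set (relatorBall m ℓ)}

theorem IsRandomGroupSequence.aas_satisfiesB (hm : 2 ≤ m) (hp : 1 ≤ p)
    (hR : IsRandomGroupSequence m d P R) (hd : d < ((1 / (2 * (p : ℝ) + 2) : ℝ) : EReal)) :
    AAS P (fun ℓ ω => SatisfiesB p (Subtype.val '' R ℓ ω)) := by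
  obtain ⟨x, hdx, hx⟩ := EReal.lt_iff_exists_real_btwn.1 hd
  -- The density may be `-∞`, whereas the estimates need a nonnegative exponent.
  set c := max x 0
  have hc : c < 1 / (2 * (p : ℝ) + 2) :=
    max_lt (EReal.coe_lt_coe_iff.1 hx) (by positivity)
  have hdc : d < (c : EReal) := hdx.trans_le (EReal.coe_le_coe_iff.2 (le_max_left _ _))
  have hlim : Tendsto (fun ℓ : ℕ => ∑ k ∈ Finset.range (p + 1),
      badBound m p k ℓ * ((Nat.card (relatorBall m ℓ) : ℝ) ^ c) ^ (k + 1) /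
        (Nat.card (relatorBall m ℓ) - k)) atTop (𝓝 0) := by
    rw [← Finset.sum_const_zero (s := Finset.range (p + 1))]
    exact tendsto_finsetSum _ fun k _ => tendsto_badBound_mul_div hm hp (le_max_right _ _) hc
  refine aas_of_measureReal_le (hR.densable.2 _ (Iio_mem_nhds hdc)) hlim ?_
  filter_upwards [(tendsto_card_relatorBall hm).eventually_ge_atTop (p + 1 : ℝ)] with ℓ hℓ
  have hcard : p + 1 ≤ Nat.card (relatorBall m ℓ) := by exact_mod_cast hℓ
  refine le_trans (measureReal_mono ?_) (measureReal_not_satisfiesB_le hm hp (P ℓ)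
    (hR.isRandomSubset ℓ) (hR.permutationInvariant ℓ) (by omega) c)
  rintro ω ⟨h1, h2⟩
  exact ⟨h1, ncard_le_rpow_of_subsetDensity_lt (by omega) h2⟩

theorem IsRandomGroupSequence.aas_not_satisfiesWeakB (hm : 2 ≤ m) (hp : 1 ≤ p)
    (hR : IsRandomGroupSequence m d P R) (hd : ((1 / (2 * (p : ℝ) + 2) : ℝ) : EReal) < d) :
    AAS P (fun ℓ ω => ¬ SatisfiesWeakB p (Subtype.val '' R ℓ ω)) := by
  have hp0 : (1 : ℝ) ≤ p := by exact_mod_cast hp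
  set θ : ℝ := 1 / (2 * (p : ℝ) + 2)
  have hθ0 : 0 < θ := by positivity
  obtain ⟨x, hθx, hxd⟩ := EReal.lt_iff_exists_real_btwn.1 hd
  have hθp : θ < 1 / (2 * p) := one_div_lt_one_div_of_lt (by positivity) (by linarith)
  -- The order is `θ < β < α < γ < min x (1/(2p))`. Here `γ` bounds the density of `R ℓ` from below,
  -- `α` gives the sample size and `β` the number of labels. The bound `1/(2p)` keeps that number
  -- below half of the available blocks.
  obtain ⟨γ, hθγ, hγ⟩ := exists_between (lt_min (EReal.coe_lt_coe_iff.1 hθx) hθp)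
  obtain ⟨hγx, hγp⟩ := lt_min_iff.1 hγ
  obtain ⟨α, hθα, hαγ⟩ := exists_between hθγ
  obtain ⟨β, hθβ, hβα⟩ := exists_between hθα
  have hγd : (γ : EReal) < d := (EReal.coe_lt_coe_iff.2 hγx).trans hxd
  have hb1 := one_lt_two_mul_sub_one hm
  have hbc := cast_two_mul_sub_one hm
  have hb2 : (2 : ℝ) ≤ 2 * m - 1 := by
    have : (2 : ℝ) ≤ m := by exact_mod_cast hm
    linarith
  set b : ℝ := 2 * m - 1
  have hb0 : 0 < b := by linarith
  -- This is the least block length with `2 * p * L > ℓ`. The strict inequality is what refutes the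
  -- non-strict form.
  set L : ℕ → ℕ := fun ℓ => ℓ / (2 * p) + 1
  set k : ℕ → ℕ := fun ℓ => ℓ - p * L ℓ
  have hpL : ∀ ℓ, 2 * (p * L ℓ) ≤ ℓ + 2 * p := by
    intro ℓ
    have := Nat.mul_div_le ℓ (2 * p)
    simp only [L]
    nlinarith
  have hpL' : ∀ ℓ, ℓ < 2 * (p * L ℓ) := by
    intro ℓ
    have := Nat.lt_mul_div_succ ℓ (by omega : 0 < 2 * p)
    simp only [L]
    linarith
  have hk : ∀ᶠ ℓ : ℕ in atTop, (ℓ : ℝ) / 2 - p - 2 ≤ ((k ℓ - 2 : ℕ) : ℝ) := by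
    filter_upwards [eventually_ge_atTop (2 * p + 4)] with ℓ hℓ
    have h1 := hpL ℓ
    have h2 : ℓ ≤ 2 * (k ℓ - 2) + 2 * p + 4 := by simp only [k]; omega
    have h3 : (ℓ : ℝ) ≤ 2 * ((k ℓ - 2 : ℕ) : ℝ) + 2 * p + 4 := by exact_mod_cast h2
    linarith
  have hαβ : 1 / 2 < α + p * β := by
    have h1 : (p + 1) * θ = 1 / 2 := by simp only [θ]; field_simp
    have h2 : p * θ < p * β := by gcongr
    linarith
  have hlim := (tendsto_pow_ceil_mul_exp_neg_ceil (x := 1 / (8 * b ^ 5)) hb2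
    (hθ0.trans hθβ).le hβα (by positivity) L (fun ℓ => by
      have := Nat.div_le_self ℓ (2 * p)
      simp only [L]
      omega)).add (tendsto_exp_neg_ceil_mul hb1 hαβ k hk)
  rw [add_zero] at hlim
  refine aas_of_measureReal_le (hR.densable.2 _ (Ioi_mem_nhds hγd)) hlim ?_
  filter_upwards [eventually_ge_atTop (2 * p + 16),
    (tendsto_card_relatorBall hm).eventually_ge_atTop 2,
    eventually_mul_rpow_le_rpow hb1 hαγ (4 * b ^ (2 * γ)),
    eventually_mul_rpow_le_rpow hb1 (hβα.trans (hαγ.trans hγp)) (4 * b ^ (2 : ℝ)),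
    eventually_ge_atTop (2 * p)] with ℓ hℓ hcard hM hK hℓp
  have hcard' : 2 ≤ Nat.card (relatorBall m ℓ) := by exact_mod_cast hcard
  have hL2 : 2 ≤ L ℓ := by
    have := Nat.div_pos hℓp (by omega : 0 < 2 * p)
    simp only [L]
    omega
  have hLℓ : 2 * L ℓ ≤ ℓ + 2 := by
    have h1 : ℓ / (2 * p) ≤ ℓ / 2 := Nat.div_le_div_left (by omega) (by omega)
    simp only [L]
    omega
  have hpk : p * L ℓ + k ℓ = ℓ := by
    have := hpL ℓ
    simp only [k]
    omega
  have hk2 : 2 ≤ k ℓ := by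
    have := hpL ℓ
    omega
  have hKL : 2 * ⌈b ^ (β * (ℓ : ℝ))⌉₊ ≤ (2 * m - 1) ^ (L ℓ - 2) := by
    have h1 : (⌈b ^ (β * (ℓ : ℝ))⌉₊ : ℝ) ≤ 2 * b ^ (β * (ℓ : ℝ)) :=
      ceil_le_two_mul (Real.one_le_rpow hb1.le (mul_nonneg (hθ0.trans hθβ).le (by positivity)))
    have h2 : b ^ (1 / (2 * p) * (ℓ : ℝ)) ≤ b ^ (L ℓ - 2) * b ^ (2 : ℝ) := by
      rw [← Real.rpow_natCast, ← Real.rpow_add hb0]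
      refine Real.rpow_le_rpow_of_exponent_le hb1.le ?_
      rw [Nat.cast_sub hL2]
      have h3 : (ℓ : ℝ) ≤ 2 * (p * L ℓ) := by exact_mod_cast (hpL' ℓ).le
      rw [one_div_mul_eq_div, div_le_iff₀ (by positivity)]
      push_cast
      linarith
    have h4 : 0 < b ^ (2 : ℝ) := by positivity
    have h5 : 2 * (⌈b ^ (β * (ℓ : ℝ))⌉₊ : ℝ) ≤ b ^ (L ℓ - 2) := by
      refine le_of_mul_le_mul_right ?_ h4
      calc 2 * (⌈b ^ (β * (ℓ : ℝ))⌉₊ : ℝ) * b ^ (2 : ℝ)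
          ≤ 2 * (2 * b ^ (β * (ℓ : ℝ))) * b ^ (2 : ℝ) := by gcongr
        _ = 4 * b ^ (2 : ℝ) * b ^ (β * (ℓ : ℝ)) := by ring
        _ ≤ _ := hK.trans h2
    refine (Nat.cast_le (α := ℝ)).1 ?_
    rw [Nat.cast_pow, hbc, Nat.cast_mul, Nat.cast_ofNat]
    exact h5
  refine le_trans (measureReal_mono ?_) (measureReal_satisfiesWeakB_le hm (P ℓ)
    (hR.isRandomSubset ℓ) (hR.permutationInvariant ℓ) (M := ⌈b ^ (α * (ℓ : ℝ))⌉₊) hL2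
    (by omega) hk2 hpk (hpL' ℓ) hKL)
  rintro ω ⟨h1, h2⟩
  refine ⟨not_not.1 h1, ?_⟩
  have h3 := rpow_le_ncard_of_lt_subsetDensity hcard' h2
  have h4 : b ^ (γ * ((ℓ : ℝ) - 2)) ≤ (Nat.card (relatorBall m ℓ) : ℝ) ^ γ := by
    rw [mul_comm, Real.rpow_mul hb0.le]
    exact Real.rpow_le_rpow (by positivity) (rpow_le_card_relatorBall hm (by omega))
      (by linarith)
  have h5 : (⌈b ^ (α * (ℓ : ℝ))⌉₊ : ℝ) ≤ 2 * b ^ (α * (ℓ : ℝ)) :=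
    ceil_le_two_mul (Real.one_le_rpow hb1.le (mul_nonneg (hθ0.trans hθα).le (by positivity)))
  have h6 : b ^ (γ * (ℓ : ℝ)) = b ^ (γ * ((ℓ : ℝ) - 2)) * b ^ (2 * γ) := by
    rw [← Real.rpow_add hb0]; ring_nf
  have h7 : 4 * b ^ (α * (ℓ : ℝ)) ≤ b ^ (γ * ((ℓ : ℝ) - 2)) := by
    refine le_of_mul_le_mul_right ?_ (by positivity : 0 < b ^ (2 * γ))
    linarith
  have h8 : 2 * (⌈b ^ (α * (ℓ : ℝ))⌉₊ : ℝ) ≤ (R ℓ ω).ncard := by linarith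
  exact_mod_cast h8

end AsymptoticallyAlmostSurely

theorem mainTheorem7 {Ω : ℕ → Type*} [∀ ℓ, MeasurableSpace (Ω ℓ)]
    (P : ∀ ℓ, Measure (Ω ℓ)) [∀ ℓ, IsProbabilityMeasure (P ℓ)]
    (m : ℕ) (hm : 2 ≤ m) (p : ℕ) (hp : 1 ≤ p) (d : EReal)
    (R : ∀ ℓ, Ω ℓ → Set (relatorBall m ℓ)) (hR : IsRandomGroupSequence m d P R) :
    (d < ((1 / (2 * (p : ℝ) + 2) : ℝ) : EReal) →
      AAS P (fun ℓ ω => SatisfiesB p (Subtype.val '' R ℓ ω)) ∧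
      AAS P (fun ℓ ω => SatisfiesWeakB p (Subtype.val '' R ℓ ω))) ∧
    (((1 / (2 * (p : ℝ) + 2) : ℝ) : EReal) < d →
      AAS P (fun ℓ ω => ¬ SatisfiesB p (Subtype.val '' R ℓ ω)) ∧
      AAS P (fun ℓ ω => ¬ SatisfiesWeakB p (Subtype.val '' R ℓ ω))) := by
  constructor
  · intro hd
    have h := hR.aas_satisfiesB hm hp hd
    exact ⟨h, h.mono fun _ _ hB => hB.satisfiesWeakB⟩
  · intro hd
    have h := hR.aas_not_satisfiesWeakB hm hp hd
    exact ⟨h.mono fun _ _ hW hB => hW hB.satisfiesWeakB, h⟩
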